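/- **Conventions.** A rational instance of $\mathrm{EDGP}_1$ is a simple undirected graph $G=(V,E)$ with $V=\{0,\dots,n-1\}$ and a weight function $d:E\to\mathbb{Q}_{\ge 0}$ (integer weights are a special case). A realization is a map $x:V\to\mathbb{R}^1$ with $\|x_u-x_v\|_2^2=d_{uv}^2$ for all $\{u,v\}\in E$. The instance is a YES instance if it has a realization. An instance is given as a word over a finite alphabet that lists, row by row, the entries below the diagonal of its weighted adjacency matrix: each entry is either a mark for a missing edge or the weight as a fraction of two binary numerals (not necessarily in lowest terms). A rational vector is given as the list of its coordinates, each a fraction of binary numerals with an optional minus sign. The size of an instance or of a vector is the length of such a word. Turing machines are multitape machines; a nondeterministic machine decides a set of words in polynomial time if, for some polynomial $p$ and every input word $w$, every branch of the computation halts within $p(|w|)$ steps, and some branch accepts if and only if $w$ is in the set. **Statement.** 1. There is a nondeterministic polynomial-time Turing machine that decides the set of the words encoding YES instances of $\mathrm{EDGP}_1$; that is, $\mathrm{EDGP}_1\in\mathbf{NP}$. 2. Let $(G,d)$ be a rational instance with $G$ connected, $x$ a realization of it on the line, $z\in V$ and $q\in\mathbb{Q}$. Then the translated realization $v\mapsto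 x_v-x_z+q$ has only rational components. In particular, every YES instance on a connected graph has a rational realization. 3. Rational realizations are polynomial-size certificates for $\mathrm{EDGP}_1$: there is a polynomial $p$ such that every YES instance (on a connected graph or not) that is encoded by a word $w$ has a rational realization encoded by a word of length at most $p(|w|)$, and there is a deterministic polynomial-time Turing machine that decides the set of the pairs $(w,c)$ of words such that $w$ encodes an instance and $c$ encodes a rational realization of it. -/

import Mathlib

open scoped NNRat

/-! ### Nondeterministic multitape Turing machines -/

/-- A nondeterministic Turing machine with `k` two-way infinite tapes and input alphabet `σ`.
The default letter of the tape alphabet is the blank. In state `q`, reading `s i` on tape `i`, the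
machine may make any of the moves in `moves q s`: a move gives the new state and, for each tape,
the letter to write and the direction of the head (`none`: the head stays).
If there is no move, the machine halts. -/
structure NTM (σ : Type) (k : ℕ) where
  State : Type
  [finiteState : Finite State]
  Letter : Type
  [finiteLetter : Finite Letter]
  [inhabitedLetter : Inhabited Letter]
  inputLetter : σ ↪ Letter
  inputLetter_ne_blank : ∀ a, inputLetter a ≠ default
  start : State
  accepting : Set State
  moves : State → (Fin k → Letter) → Set (State × (Fin k → Letter × Option Turing.Dir))

namespace NTM

attribute [instance] NTM.finiteState NTM.finiteLetter NTM.inhabitedLetter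

variable {σ : Type} {k m : ℕ}

/-- A configuration: the state and the tapes (with the positions of the heads). -/
structure Cfg (M : NTM σ k) where
  state : M.State
  tape : Fin k → Turing.Tape M.Letter

/-- Write a letter under the head, then move the head. -/
def act {Γ : Type} [Inhabited Γ] (T : Turing.Tape Γ) (a : Γ × Option Turing.Dir) :
    Turing.Tape Γ :=
  match a.2 with
  | none => T.write a.1
  | some d => (T.write a.1).move d

/-- One step of computation. -/
def Step (M : NTM σ k) (c c' : M.Cfg) : Prop :=
  ∃ a ∈ M.moves c.state (fun i => (c.tape i).head),
    c'.state = a.1 ∧ ∀ i, c'.tape i = act (c.tape i) (a.2 i)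

/-- `M.Reaches t c c'`: some computation of exactly `t` steps leads from `c` to `c'`. -/
inductive Reaches (M : NTM σ k) : ℕ → M.Cfg → M.Cfg → Prop
  | refl (c : M.Cfg) : Reaches M 0 c c
  | tail {t : ℕ} {c c' c'' : M.Cfg} : Reaches M t c c' → M.Step c' c'' → Reaches M (t + 1) c c''

/-- The initial configuration: the `i`-th input word is on the `i`-th tape, the head is on its first
letter, and all the other tapes are blank. -/
def init (M : NTM σ k) (input : Fin m → List σ) : M.Cfg where
  state := M.start
  tape i := if h : i.val < m then Turing.Tape.mk₁ ((input ⟨i.val, h⟩).map M.inputLetter)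
    else Turing.Tape.mk₁ []

/-- Some branch of the computation halts in an accepting state. -/
def Accepts (M : NTM σ k) (input : Fin m → List σ) : Prop :=
  ∃ t c, M.Reaches t (M.init input) c ∧ (∀ c', ¬ M.Step c c') ∧ c.state ∈ M.accepting

/-- Every branch of the computation halts after at most `t` steps. -/
def HaltsWithin (M : NTM σ k) (input : Fin m → List σ) (t : ℕ) : Prop :=
  ∀ t' c, M.Reaches t' (M.init input) c → t' ≤ t

/-- The machine has at most one move in every situation. -/
def IsDeterministic (M : NTM σ k) : Prop :=
  ∀ q s, (M.moves q s).Subsingleton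

/-- The machine decides the set `L` of (tuples of) words in polynomial time: on every input, every
branch halts within a number of steps that is polynomial in the input length, and some branch
accepts if and only if the input is in `L`. -/
def DecidesInPolyTime (M : NTM σ k) (L : Set (Fin m → List σ)) : Prop :=
  ∃ p : Polynomial ℕ, ∀ input : Fin m → List σ,
    M.HaltsWithin input (p.eval (∑ i, (input i).length)) ∧ (M.Accepts input ↔ input ∈ L)

end NTM

/-- `L` is decided by a nondeterministic polynomial-time Turing machine. -/
def NondeterministicPolyTime {σ : Type} {m : ℕ} (L : Set (Fin m → List σ)) : Prop :=
  ∃ (k : ℕ) (M : NTM σ k), M.DecidesInPolyTime L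

/-- `L` is decided by a deterministic polynomial-time Turing machine. -/
def DeterministicPolyTime {σ : Type} {m : ℕ} (L : Set (Fin m → List σ)) : Prop :=
  ∃ (k : ℕ) (M : NTM σ k), M.IsDeterministic ∧ M.DecidesInPolyTime L

/-! ### The Euclidean distance geometry problem -/

/-- `x` is a realization in `ℝ^K` of the simple graph `G` with edge weights `d`. -/
def IsRealization {V : Type} (K : ℕ) (G : SimpleGraph V) (d : G.edgeSet → ℝ)
    (x : V → EuclideanSpace ℝ (Fin K)) : Prop :=
  ∀ u v (h : G.Adj u v), ‖x u - x v‖ ^ 2 = d ⟨s(u, v), h⟩ ^ 2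

/-- A rational instance: a simple graph on the vertices `0, …, n - 1` with nonnegative rational
edge weights. -/
structure EDGPInstance where
  n : ℕ
  graph : SimpleGraph (Fin n)
  weight : graph.edgeSet → ℚ≥0

namespace EDGPInstance

/-- `x` is a realization of the instance in dimension `K`. -/
def Realizes (I : EDGPInstance) (K : ℕ) (x : Fin I.n → EuclideanSpace ℝ (Fin K)) : Prop :=
  IsRealization K I.graph (fun e => (I.weight e : ℝ)) x

/-- The instance is a YES instance of the problem in dimension `K`. -/
def IsYes (I : EDGPInstance) (K : ℕ) : Prop :=
  ∃ x, I.Realizes K x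

/-- `y` is a realization on the line with rational coordinates. -/
def RationalRealizes (I : EDGPInstance) (y : Fin I.n → ℚ) : Prop :=
  I.Realizes 1 (fun v => !₂[(y v : ℝ)])

end EDGPInstance

/-! ### Encoding of instances and of rational realizations by words -/

/-- The alphabet: binary digits, fraction bar, minus sign, end of entry, missing edge, end of row. -/
inductive Symb
  | bit (b : Bool)
  | slash
  | minus
  | comma
  | noEdge
  | endRow
  deriving DecidableEq, Fintype

/-- The value of a binary numeral, least significant digit first. -/
def bitsValue (l : List Bool) : ℕ :=
  Nat.ofDigits 2 (l.map Bool.toNat)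

/-- The word `w` is a fraction `p/q` of binary numerals with value `r` (not necessarily in lowest
terms). -/
def EncodesNNRat (r : ℚ≥0) (w : List Symb) : Prop :=
  ∃ p q : List Bool, bitsValue q ≠ 0 ∧ r = (bitsValue p : ℚ≥0) / (bitsValue q : ℚ≥0) ∧
    w = p.map Symb.bit ++ Symb.slash :: q.map Symb.bit

/-- The word `w` is a fraction, possibly after a minus sign, with value `r`. -/
def EncodesRat (r : ℚ) (w : List Symb) : Prop :=
  ∃ (s : ℚ≥0) (v : List Symb), EncodesNNRat s v ∧
    ((r = s ∧ w = v) ∨ (r = -s ∧ w = Symb.minus :: v))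

namespace EDGPInstance

/-- The word `w` describes the `(i, j)` entry of the weighted adjacency matrix. -/
def EncodesEntry (I : EDGPInstance) (i j : Fin I.n) (w : List Symb) : Prop :=
  (∃ h : I.graph.Adj i j, EncodesNNRat (I.weight ⟨s(i, j), h⟩) w) ∨
    (¬ I.graph.Adj i j ∧ w = [Symb.noEdge])

/-- The word `w` lists, row by row, the entries of the weighted adjacency matrix of the instance
below the diagonal (row `i` has the entries `(i, j)` with `j < i`). -/
def Encodes (I : EDGPInstance) (w : List Symb) : Prop :=
  ∃ e : Fin I.n → Fin I.n → List Symb, (∀ i j, j < i → I.EncodesEntry i j (e i j)) ∧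
    w = (List.finRange I.n).flatMap fun i =>
      (((List.finRange I.n).filter fun j => j < i).flatMap fun j => e i j ++ [Symb.comma]) ++
        [Symb.endRow]

end EDGPInstance

/-- The word `w` lists the coordinates of the rational vector `y`. -/
def EncodesVector {n : ℕ} (y : Fin n → ℚ) (w : List Symb) : Prop :=
  ∃ e : Fin n → List Symb, (∀ v, EncodesRat (y v) (e v)) ∧
    w = (List.finRange n).flatMap fun v => e v ++ [Symb.comma]

/-- The words that encode the YES instances of the problem on the line. -/
def EDGP1 : Set (Fin 1 → List Symb) :=
  {input | ∃ I : EDGPInstance, I.Encodes (input 0) ∧ I.IsYes 1}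

/-- The pairs of words that encode an instance and a rational realization of it on the line. -/
def EDGP1Certificates : Set (Fin 2 → List Symb) :=
  {input | ∃ (I : EDGPInstance) (y : Fin I.n → ℚ),
    I.Encodes (input 0) ∧ EncodesVector y (input 1) ∧ I.RationalRealizes y}

/-!
A realization on the line determines the difference of the coordinates of two adjacent vertices up
to a sign, so along a walk the differences add up to a signed sum of edge weights. Hence a
realization becomes rational on a connected component as soon as one coordinate in the component is
rational (`exists_rat_realization_of_connected`). Moreover, the product `D` of the denominators that
are written in the word `w` of the instance is a common denominator of all the weights, and it is
at most `2 ^ |w|`. Translating each component so that one of its vertices gets the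
coordinate `0` makes every coordinate an integer divided by `D`; a path has fewer than
`2 ^ |w|` edges, and each weight is at most `2 ^ |w|`, so numerators with `3 |w|` digits suffice.
This gives certificates of quadratic length (`exists_short_certificate`).

The rest of the proof is about machines. Algorithms are written as programs `Prog` that act on
finitely many stacks, and such a program is compiled to a multitape machine with one tape for each
stack, the top of the stack under the head (`Prog.ntm_spec`). Running times and nondeterministic
choices of a program are, step by step, those of the machine: the choices are read from a stream
`ω`, at the position given by the number of the step. The class `PolyTime` of the functions that are
computed by programs without guesses in polynomial time, from tuples of words to tuples of words,
contains the projections and the elementary operations on words and is closed under composition,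
pairing, branching and iteration over the letters of a word, as long as the intermediate results are
of polynomial size (`PolyTime.foldl`). From then on no machine is mentioned: that an algorithm takes
polynomial time is proved by writing it as a composition of such functions.

The verifier `verify` first tests that the certificate `c` is a list of fractions. Then it reads the
word `w` once, and keeps the two suffixes of `c` that start with the coordinates of the vertices of
the current row and column. Each entry of the matrix is compared with the difference of these two
coordinates after clearing denominators, which takes some additions, multiplications and
comparisons of natural numbers. The verifier accepts exactly the pairs in `EDGP1Certificates`
(`mem_certificates_iff`), and so it gives the deterministic machine
(`PolyTime.deterministicPolyTime`). The nondeterministic machine guesses a word that is at most as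
long as the word `clock w` and then verifies it (`PolyTime.nondeterministicPolyTime`); by the bound
on certificates this decides `EDGP1`.
-/

/-! ### Stack programs -/

/-- A store: an infinite family of stacks of letters, of which each program uses only finitely many
(`Prog.exists_bdd`). The top of a stack is the head of the list. -/
abbrev Store := ℕ → List Symb

/-- Programs that act on a store. `push i a` pushes `a` on stack `i`; `guess i` nondeterministically
pushes a letter on stack `i` or leaves it alone; `case i f` pops stack `i` and branches on the
letter obtained (`none` if the stack was empty); `loop i f` pops stack `i` and runs `f a` for the
letter `a` obtained, until stack `i` is empty. -/
inductive Prog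
  | skip
  | push (i : ℕ) (a : Symb)
  | guess (i : ℕ)
  | seq (P Q : Prog)
  | case (i : ℕ) (f : Option Symb → Prog)
  | loop (i : ℕ) (f : Symb → Prog)

namespace Prog

/-- `Run ω P τ s τ' s'`: started at time `τ` in the store `s`, the program `P` ends at time `τ'` in
the store `s'`. Nondeterminism is resolved by the stream `ω`: a guess made at time `τ` has the
outcome `ω τ`. The times are those of the Turing machine compiled from the program, see
`Prog.frag`. -/
inductive Run (ω : ℕ → Option Symb) : Prog → ℕ → Store → ℕ → Store → Prop
  | skip (τ s) : Run ω skip τ s (τ + 1) s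
  | push (i a τ s) : Run ω (push i a) τ s (τ + 2) (Function.update s i (a :: s i))
  | guess (i τ s) :
      Run ω (guess i) τ s (τ + 2) (Function.update s i ((ω (τ + 1)).toList ++ s i))
  | seq {P Q τ s τ' s' τ'' s''} : Run ω P τ s τ' s' → Run ω Q τ' s' τ'' s'' →
      Run ω (seq P Q) τ s τ'' s''
  | case {i f τ s τ' s'} :
      Run ω (f (s i).head?) (τ + 1) (Function.update s i (s i).tail) τ' s' →
      Run ω (case i f) τ s τ' s'
  | loop_nil {i f τ s} : s i = [] → Run ω (loop i f) τ s (τ + 1) s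
  | loop_cons {i f τ s a l τ' s' τ'' s''} : s i = a :: l →
      Run ω (f a) (τ + 1) (Function.update s i l) τ' s' →
      Run ω (loop i f) τ' s' τ'' s'' → Run ω (loop i f) τ s τ'' s''

/-- All stacks named in the program have a number less than `k`. -/
def Bdd (k : ℕ) : Prog → Prop
  | skip => True
  | push i _ => i < k
  | guess i => i < k
  | seq P Q => P.Bdd k ∧ Q.Bdd k
  | case i f => i < k ∧ ∀ o, (f o).Bdd k
  | loop i f => i < k ∧ ∀ a, (f a).Bdd k

/-- The program makes no guesses. -/
def GuessFree : Prog → Prop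
  | skip => True
  | push _ _ => True
  | guess _ => False
  | seq P Q => P.GuessFree ∧ Q.GuessFree
  | case _ f => ∀ o, (f o).GuessFree
  | loop _ f => ∀ a, (f a).GuessFree

theorem Bdd.mono {P : Prog} {k k' : ℕ} (h : P.Bdd k) (hk : k ≤ k') : P.Bdd k' := by
  induction P with
  | skip => trivial
  | push i a => exact lt_of_lt_of_le h hk
  | guess i => exact lt_of_lt_of_le h hk
  | seq P Q hP hQ => exact ⟨hP h.1, hQ h.2⟩
  | case i f ih => exact ⟨h.1.trans_le hk, fun o => ih o (h.2 o)⟩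
  | loop i f ih => exact ⟨h.1.trans_le hk, fun o => ih o (h.2 o)⟩

theorem exists_bdd (P : Prog) : ∃ k, P.Bdd k := by
  induction P with
  | skip => exact ⟨0, trivial⟩
  | push i a => exact ⟨i + 1, Nat.lt_succ_self i⟩
  | guess i => exact ⟨i + 1, Nat.lt_succ_self i⟩
  | seq P Q hP hQ =>
    obtain ⟨k, hk⟩ := hP
    obtain ⟨l, hl⟩ := hQ
    exact ⟨max k l, hk.mono (le_max_left _ _), hl.mono (le_max_right _ _)⟩
  | case i f ih =>
    choose g hg using ih
    exact ⟨max (i + 1) (Finset.univ.sup g), lt_of_lt_of_le (Nat.lt_succ_self i) (le_max_left _ _),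
      fun o => (hg o).mono ((Finset.le_sup (Finset.mem_univ o)).trans (le_max_right _ _))⟩
  | loop i f ih =>
    choose g hg using ih
    exact ⟨max (i + 1) (Finset.univ.sup g), lt_of_lt_of_le (Nat.lt_succ_self i) (le_max_left _ _),
      fun o => (hg o).mono ((Finset.le_sup (Finset.mem_univ o)).trans (le_max_right _ _))⟩

end Prog

/-! ### Compilation of stack programs to Turing machines -/

/-- A part of a Turing machine with `k` tapes and tape alphabet `Option Symb`, with one entry and
one exit. The transition function has an additional argument, a guess; its value has the new state
`none` if the machine leaves this part. -/
structure Frag (k : ℕ) where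
  State : Type
  [finiteState : Finite State]
  start : State
  next : State → (Fin k → Option Symb) → Option Symb →
    Option State × (Fin k → Option Symb × Option Turing.Dir)

namespace Frag

attribute [instance] Frag.finiteState

variable {k : ℕ}

/-- The letter under the head of tape `i`. -/
def hd (h : Fin k → Option Symb) (i : ℕ) : Option Symb :=
  if hi : i < k then h ⟨i, hi⟩ else none

/-- Leave all tapes unchanged. -/
def nop (h : Fin k → Option Symb) : Fin k → Option Symb × Option Turing.Dir :=
  fun j => (h j, none)

/-- Act on tape `i` alone. -/
def only (h : Fin k → Option Symb) (i : ℕ) (b : Option Symb × Option Turing.Dir) :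
    Fin k → Option Symb × Option Turing.Dir :=
  fun j => if j.val = i then b else (h j, none)

/-- The tapes that hold a store: the top of stack `i` is under the head of tape `i`, the rest of
the stack is to the right of the head, and everything else is blank. -/
def tapes (k : ℕ) (s : Store) : Fin k → Turing.Tape (Option Symb) :=
  fun j => Turing.Tape.mk₁ ((s j).map some)

/-- The letters under the heads. -/
def heads (T : Fin k → Turing.Tape (Option Symb)) : Fin k → Option Symb := fun j => (T j).head

/-- `Exits ω F τ q T τ' T'`: from the state `q` and the tapes `T` at time `τ`, the machine leaves
the part `F` at time `τ'` with the tapes `T'`, where `ω` provides the guesses. -/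
inductive Exits (ω : ℕ → Option Symb) (F : Frag k) :
    ℕ → F.State → (Fin k → Turing.Tape (Option Symb)) → ℕ →
      (Fin k → Turing.Tape (Option Symb)) → Prop
  | exit {τ q T} : (F.next q (heads T) (ω τ)).1 = none →
      Exits ω F τ q T (τ + 1) (fun j => NTM.act (T j) ((F.next q (heads T) (ω τ)).2 j))
  | step {τ q q' T τ' T'} : (F.next q (heads T) (ω τ)).1 = some q' →
      Exits ω F (τ + 1) q' (fun j => NTM.act (T j) ((F.next q (heads T) (ω τ)).2 j)) τ' T' →
      Exits ω F τ q T τ' T'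

/-- The part that does nothing. -/
def skip : Frag k where
  State := Unit
  start := ()
  next _ h _ := (none, nop h)

/-- Push a letter: move to the left, then write. -/
def push (i : ℕ) (a : Symb) : Frag k where
  State := Bool
  start := false
  next q h _ := match q with
    | false => (some true, only h i (hd h i, some .left))
    | true => (none, only h i (some a, none))

/-- Push a guessed letter, or no letter. -/
def guess (i : ℕ) : Frag k where
  State := Bool
  start := false
  next q h o := match q with
    | false => (some true, only h i (hd h i, some .left))
    | true => (none, only h i (match o with
        | none => (none, some .right)
        | some a => (some a, none)))

/-- Enter the second part on leaving the first. -/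
def seq (F G : Frag k) : Frag k where
  State := F.State ⊕ G.State
  start := .inl F.start
  next q h o := match q with
    | .inl q => (some (match (F.next q h o).1 with
        | none => .inr G.start
        | some q' => .inl q'), (F.next q h o).2)
    | .inr q => ((G.next q h o).1.map .inr, (G.next q h o).2)

/-- Pop a letter and enter the part chosen by it. -/
def case (i : ℕ) (F : Option Symb → Frag k) : Frag k where
  State := Option (Σ o, (F o).State)
  start := none
  next q h o := match q with
    | none => (some (some ⟨hd h i, (F (hd h i)).start⟩), only h i (none, some .right))
    | some ⟨b, q⟩ => (((F b).next q h o).1.map fun q' => some ⟨b, q'⟩, ((F b).next q h o).2)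

/-- Pop a letter and enter the part chosen by it, until there is no letter. -/
def loop (i : ℕ) (F : Symb → Frag k) : Frag k where
  State := Option (Σ a, (F a).State)
  start := none
  next q h o := match q with
    | none => match hd h i with
      | none => (none, nop h)
      | some a => (some (some ⟨a, (F a).start⟩), only h i (none, some .right))
    | some ⟨b, q⟩ => (some (((F b).next q h o).1.map fun q' => ⟨b, q'⟩), ((F b).next q h o).2)

/-- A run of `F` inside of a larger part `G`, where leaving `F` means leaving `G`. -/
theorem Exits.embed {ω} {F G : Frag k} (e : F.State → G.State)
    (he : ∀ q h o, G.next (e q) h o = ((F.next q h o).1.map e, (F.next q h o).2))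
    {τ q T τ' T'} (H : Exits ω F τ q T τ' T') : Exits ω G τ (e q) T τ' T' := by
  induction H with
  | @exit τ q T h =>
    have := Exits.exit (ω := ω) (F := G) (τ := τ) (q := e q) (T := T) (by simp [he, h])
    simpa [he] using this
  | @step τ q q' T τ' T' h _ ih =>
    refine Exits.step (q' := e q') (by simp [he, h]) ?_
    simpa [he] using ih

/-- A run of `F` inside of a larger part `G`, where leaving `F` leads to the state `r` of `G`. -/
theorem Exits.embed_then {ω} {F G : Frag k} (e : F.State → G.State) (r : G.State)
    (he : ∀ q h o, G.next (e q) h o = (some (match (F.next q h o).1 with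
      | none => r
      | some q' => e q'), (F.next q h o).2))
    {τ q T τ' T' τ'' T''} (H : Exits ω F τ q T τ' T') (H' : Exits ω G τ' r T' τ'' T'') :
    Exits ω G τ (e q) T τ'' T'' := by
  induction H with
  | @exit τ q T h =>
    refine Exits.step (q' := r) (by simp [he, h]) ?_
    simpa [he] using H'
  | @step τ q q' T τ' T' h _ ih =>
    refine Exits.step (q' := e q') (by simp [he, h]) ?_
    simpa [he] using ih H'

theorem listBlank_mk_singleton_none :
    (Turing.ListBlank.mk [(none : Option Symb)]) = Turing.ListBlank.mk [] :=
  Quotient.sound' (Or.inr ⟨1, rfl⟩)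

theorem heads_tapes (s : Store) (j : Fin k) : heads (tapes k s) j = (s j).head? := by
  simp only [heads, tapes, Turing.Tape.mk₁, Turing.Tape.mk₂, Turing.Tape.mk'_head,
    Turing.ListBlank.head_mk]
  cases s j <;> rfl

theorem hd_heads_tapes (s : Store) {i : ℕ} (hi : i < k) :
    hd (heads (tapes k s)) i = (s i).head? := by
  simp [hd, hi, heads_tapes]

theorem act_nop (T : Fin k → Turing.Tape (Option Symb)) :
    (fun j => NTM.act (T j) (nop (heads T) j)) = T := by
  funext j
  exact Turing.Tape.write_self _

theorem act_only (T : Fin k → Turing.Tape (Option Symb)) (i : ℕ) (b) :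
    (fun j => NTM.act (T j) (only (heads T) i b j)) =
      fun j => if j.val = i then NTM.act (T j) b else T j := by
  funext j
  unfold only
  split_ifs
  · rfl
  · exact Turing.Tape.write_self _

theorem act_only_only (T : Fin k → Turing.Tape (Option Symb)) (i : ℕ) (b b') :
    (fun j => NTM.act (NTM.act (T j) (only (heads T) i b j))
        (only (heads fun j => NTM.act (T j) (only (heads T) i b j)) i b' j)) =
      fun j => if j.val = i then NTM.act (NTM.act (T j) b) b' else T j := by
  rw [act_only fun j => NTM.act (T j) (only (heads T) i b j)]
  funext j
  rw [congrFun (act_only T i b) j]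
  split_ifs <;> rfl

theorem act_pop (l : List Symb) :
    NTM.act (Turing.Tape.mk₁ (l.map some)) ((none : Option Symb), some .right) =
      Turing.Tape.mk₁ (l.tail.map some) := by
  simp only [NTM.act, Turing.Tape.mk₁, Turing.Tape.mk₂, Turing.Tape.write_mk',
    Turing.Tape.move_right_mk', Turing.ListBlank.head_cons, Turing.ListBlank.tail_cons]
  simp only [Turing.ListBlank.cons_mk, listBlank_mk_singleton_none, Turing.ListBlank.tail_mk,
    List.map_tail]

theorem act_left (l : List Symb) :
    NTM.act (Turing.Tape.mk₁ (l.map some)) (l.head?, some .left) =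
      Turing.Tape.mk' (Turing.ListBlank.mk [])
        (Turing.ListBlank.cons none (Turing.ListBlank.mk (l.map some))) := by
  have h : (Turing.Tape.mk₁ (l.map some)).head = l.head? := by
    simp only [Turing.Tape.mk₁, Turing.Tape.mk₂, Turing.Tape.mk'_head, Turing.ListBlank.head_mk]
    cases l <;> rfl
  simp only [NTM.act]
  rw [← h, Turing.Tape.write_self]
  simp only [Turing.Tape.mk₁, Turing.Tape.mk₂, Turing.Tape.move_left_mk',
    Turing.ListBlank.head_mk, Turing.ListBlank.tail_mk]
  rfl

theorem act_write (l : List Symb) (a : Symb) :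
    NTM.act (Turing.Tape.mk' (Turing.ListBlank.mk [])
        (Turing.ListBlank.cons none (Turing.ListBlank.mk (l.map some)))) (some a, none) =
      Turing.Tape.mk₁ ((a :: l).map some) := by
  simp [NTM.act, Turing.Tape.mk₁, Turing.Tape.mk₂, Turing.ListBlank.cons_mk]

theorem act_back (l : List Symb) :
    NTM.act (Turing.Tape.mk' (Turing.ListBlank.mk [])
        (Turing.ListBlank.cons none (Turing.ListBlank.mk (l.map some))))
          ((none : Option Symb), some .right) =
      Turing.Tape.mk₁ (l.map some) := by
  simp only [NTM.act, Turing.Tape.mk₁, Turing.Tape.mk₂, Turing.Tape.write_mk',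
    Turing.Tape.move_right_mk', Turing.ListBlank.head_cons, Turing.ListBlank.tail_cons]
  simp only [Turing.ListBlank.cons_mk, listBlank_mk_singleton_none]

theorem tapes_update (s : Store) (i : ℕ) (l : List Symb) :
    tapes k (Function.update s i l) =
      fun j => if j.val = i then Turing.Tape.mk₁ (l.map some) else tapes k s j := by
  funext j
  unfold tapes Function.update
  split_ifs with h <;> simp

theorem act_only_pop (s : Store) (i : ℕ) :
    (fun j => NTM.act (tapes k s j) (only (heads (tapes k s)) i (none, some .right) j)) =
      tapes k (Function.update s i (s i).tail) := by
  rw [act_only, tapes_update]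
  funext j
  split_ifs with h
  · subst h
    exact act_pop _
  · rfl

end Frag

namespace Prog

open Frag

variable {k : ℕ}

/-- The part of a Turing machine that executes a program. -/
def frag (k : ℕ) : Prog → Frag k
  | skip => Frag.skip
  | push i a => Frag.push i a
  | guess i => Frag.guess i
  | seq P Q => (P.frag k).seq (Q.frag k)
  | case i f => Frag.case i fun o => (f o).frag k
  | loop i f => Frag.loop i fun a => (f a).frag k

theorem Run.exits {ω} {P : Prog} {τ s τ' s'} (H : Run ω P τ s τ' s') (hk : P.Bdd k) :
    Exits ω (P.frag k) τ (P.frag k).start (tapes k s) τ' (tapes k s') := by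
  induction H with
  | skip τ s =>
    have := Exits.exit (ω := ω) (F := (Frag.skip : Frag k)) (τ := τ) (q := ()) (T := tapes k s) rfl
    rw [show (fun j => NTM.act (tapes k s j) ((Frag.skip.next () (heads (tapes k s)) (ω τ)).2 j)) =
      tapes k s from act_nop _] at this
    exact this
  | push i a τ s =>
    refine Exits.step (q' := true) rfl ?_
    simp only [frag, Frag.push, hd_heads_tapes s hk]
    have := Exits.exit (ω := ω) (F := (Frag.push i a : Frag k)) (τ := τ + 1) (q := true)
      (T := fun j => NTM.act (tapes k s j) (only (heads (tapes k s)) i ((s i).head?, some .left) j))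
      rfl
    refine Eq.mp (congrArg (Exits ω (Frag.push i a) (τ + 1) true _ (τ + 2)) ?_) this
    simp only [Frag.push, act_only_only, tapes_update]
    funext j
    split_ifs with h
    · subst h
      simp only [tapes, act_left, act_write]
    · rfl
  | guess i τ s =>
    refine Exits.step (q' := true) rfl ?_
    simp only [frag, Frag.guess, hd_heads_tapes s hk]
    have := Exits.exit (ω := ω) (F := (Frag.guess i : Frag k)) (τ := τ + 1) (q := true)
      (T := fun j => NTM.act (tapes k s j) (only (heads (tapes k s)) i ((s i).head?, some .left) j))
      rfl
    refine Eq.mp (congrArg (Exits ω (Frag.guess i) (τ + 1) true _ (τ + 2)) ?_) this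
    simp only [Frag.guess, act_only_only, tapes_update]
    funext j
    split_ifs with h
    · subst h
      cases ω (τ + 1) with
      | none => simp only [tapes, act_left, act_back, Option.toList_none, List.nil_append]
      | some a => simp only [tapes, act_left, act_write, Option.toList_some, List.cons_append,
          List.nil_append]
    · rfl
  | @seq P Q τ s τ' s' τ'' s'' _ _ ih₁ ih₂ =>
    refine (ih₁ hk.1).embed_then (G := (P.seq Q).frag k) Sum.inl (Sum.inr (Q.frag k).start)
      (fun q h o => rfl) ?_
    exact (ih₂ hk.2).embed (G := (P.seq Q).frag k) Sum.inr (fun q h o => rfl)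
  | @case i f τ s τ' s' _ ih =>
    refine Exits.step (q' := some ⟨(s i).head?, ((f (s i).head?).frag k).start⟩) ?_ ?_
    · rw [← hd_heads_tapes s hk.1]
      rfl
    · simp only [frag, Frag.case, act_only_pop]
      exact (ih (hk.2 _)).embed (G := (Prog.case i f).frag k) (fun q' => some ⟨(s i).head?, q'⟩)
        (fun q h o => rfl)
  | @loop_nil i f τ s hs =>
    have h : hd (heads (tapes k s)) i = none := by rw [hd_heads_tapes s hk.1, hs]; rfl
    have := Exits.exit (ω := ω) (F := (Prog.loop i f).frag k) (τ := τ) (q := none)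
      (T := tapes k s) (by simp only [frag, Frag.loop, h])
    simp only [frag, Frag.loop, h, act_nop] at this
    exact this
  | @loop_cons i f τ s a l τ' s' τ'' s'' hs _ _ ih₁ ih₂ =>
    have h : hd (heads (tapes k s)) i = some a := by rw [hd_heads_tapes s hk.1, hs]; rfl
    have hl : l = (s i).tail := by rw [hs]; rfl
    refine Exits.step (q' := some ⟨a, ((f a).frag k).start⟩) ?_ ?_
    · simp only [frag, Frag.loop, h]
    · simp only [frag, Frag.loop, h, act_only_pop]
      subst hl
      refine (ih₁ (hk.2 _)).embed_then (G := (Prog.loop i f).frag k) (fun q' => some ⟨a, q'⟩) none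
        ?_ (ih₂ hk)
      intro q h o
      simp only [frag, Frag.loop]
      cases (Frag.next (frag k (f a)) q h o).1 <;> rfl

theorem GuessFree.next_eq {P : Prog} (hP : P.GuessFree) (q : (P.frag k).State) (h o o') :
    (P.frag k).next q h o = (P.frag k).next q h o' := by
  induction P with
  | skip => rfl
  | push i a => rfl
  | guess i => exact hP.elim
  | seq P Q ihP ihQ =>
    rcases q with q | q
    · simp only [frag, Frag.seq, ihP hP.1 q]
    · simp only [frag, Frag.seq, ihQ hP.2 q]
  | case i f ih =>
    rcases q with _ | ⟨b, q⟩
    · rfl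
    · simp only [frag, Frag.case, ih b (hP b) q]
  | loop i f ih =>
    rcases q with _ | ⟨b, q⟩
    · rfl
    · simp only [frag, Frag.loop, ih b (hP b) q]

/-- The transition function of the machine compiled from a program: after the run of the program,
the machine goes to the state `inr (some b)`, where `b` tells if `bit true` is on the top of
stack `0`. In these states it halts. -/
def ntmNext (P : Prog) (k : ℕ) (q : (P.frag k).State ⊕ Option Bool) (h : Fin k → Option Symb)
    (o : Option Symb) : Option (((P.frag k).State ⊕ Option Bool) ×
      (Fin k → Option Symb × Option Turing.Dir)) :=
  match q with
  | .inl q => some ((match ((P.frag k).next q h o).1 with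
      | none => .inr none
      | some q' => .inl q'), ((P.frag k).next q h o).2)
  | .inr none => some (.inr (some (decide (hd h 0 = some (.bit true)))), nop h)
  | .inr (some _) => none

/-- The Turing machine compiled from a program. -/
def ntm (P : Prog) (k : ℕ) : NTM Symb k where
  State := (P.frag k).State ⊕ Option Bool
  Letter := Option Symb
  inputLetter := ⟨some, Option.some_injective _⟩
  inputLetter_ne_blank _ := Option.some_ne_none _
  start := .inl (P.frag k).start
  accepting := {.inr (some true)}
  moves q h := {a | ∃ o, P.ntmNext k q h o = some a}

theorem GuessFree.isDeterministic {P : Prog} (hP : P.GuessFree) (k : ℕ) :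
    (P.ntm k).IsDeterministic := by
  rintro q s a ⟨o, ha⟩ b ⟨o', hb⟩
  have : P.ntmNext k q s o = P.ntmNext k q s o' := by
    rcases q with q | _ | _
    · simp only [ntmNext, hP.next_eq q s o o']
    · rfl
    · rfl
  rw [this, hb] at ha
  exact (Option.some.inj ha).symm

/-- The configuration of the compiled machine at time `τ`, if it is still running. -/
def conf (P : Prog) (k : ℕ) (ω : ℕ → Option Symb) (c : (P.ntm k).Cfg) :
    ℕ → Option (P.ntm k).Cfg
  | 0 => some c
  | τ + 1 => (conf P k ω c τ).bind fun c => (P.ntmNext k c.state (heads c.tape) (ω τ)).map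
      fun a => ⟨a.1, fun j => NTM.act (c.tape j) (a.2 j)⟩

theorem conf_congr (P : Prog) {ω ω' : ℕ → Option Symb} (c : (P.ntm k).Cfg) {τ : ℕ}
    (h : ∀ t < τ, ω t = ω' t) : conf P k ω c τ = conf P k ω' c τ := by
  induction τ with
  | zero => rfl
  | succ τ ih =>
    simp only [conf, ih fun t ht => h t (ht.trans (Nat.lt_succ_self _)), h τ (Nat.lt_succ_self _)]

theorem reaches_iff (P : Prog) (c c' : (P.ntm k).Cfg) (t : ℕ) :
    (P.ntm k).Reaches t c c' ↔ ∃ ω, conf P k ω c t = some c' := by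
  constructor
  · intro h
    induction h with
    | refl => exact ⟨fun _ => none, rfl⟩
    | @tail t c c' c'' _ hs ih =>
      obtain ⟨ω, hω⟩ := ih
      obtain ⟨a, ⟨o, ho⟩, h₁, h₂⟩ := hs
      refine ⟨Function.update ω t o, ?_⟩
      have : conf P k (Function.update ω t o) c t = some c' := by
        rw [← hω]
        exact conf_congr P c fun u hu => Function.update_of_ne hu.ne _ _
      have ho' : P.ntmNext k c'.state (heads c'.tape) o = some a := ho
      simp only [conf, this, Option.bind_some, Function.update_self, ho']
      cases c''
      cases h₁
      cases funext h₂
      rfl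
  · rintro ⟨ω, hω⟩
    induction t generalizing c' with
    | zero =>
      obtain rfl : c = c' := Option.some.inj hω
      exact .refl _
    | succ t ih =>
      simp only [conf, Option.bind_eq_some_iff, Option.map_eq_some_iff] at hω
      obtain ⟨d, hd, a, ha, rfl⟩ := hω
      exact (ih d hd).tail ⟨a, ⟨ω t, ha⟩, rfl, fun _ => rfl⟩

theorem conf_of_exits {ω} {P : Prog} {c : (P.ntm k).Cfg} {τ q T τ' T'}
    (H : Exits ω (P.frag k) τ q T τ' T') (hc : conf P k ω c τ = some ⟨.inl q, T⟩) :
    conf P k ω c τ' = some ⟨.inr none, T'⟩ := by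
  induction H with
  | @exit τ q T h =>
    simp only [conf, hc, Option.bind_some, ntmNext, h, Option.map_some]
    rfl
  | @step τ q q' T τ' T' h _ ih =>
    apply ih
    simp only [conf, hc, Option.bind_some, ntmNext, h, Option.map_some]
    rfl

theorem conf_eq_none {P : Prog} {ω} {c : (P.ntm k).Cfg} {τ τ' : ℕ} (hτ : τ ≤ τ')
    (h : conf P k ω c τ = none) : conf P k ω c τ' = none := by
  induction τ', hτ using Nat.le_induction with
  | base => exact h
  | succ n _ ih => simp only [conf, ih, Option.bind_none]

/-- The store that holds the input words. -/
def inputStore {m : ℕ} (input : Fin m → List Symb) : Store :=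
  fun i => if h : i < m then input ⟨i, h⟩ else []

/-- The compiled machine halts and answers as the program does. -/
theorem ntm_spec {P : Prog} (hk : P.Bdd k) (hk0 : 0 < k) {m : ℕ} (input : Fin m → List Symb)
    {t : (ℕ → Option Symb) → ℕ} {s : (ℕ → Option Symb) → Store}
    (hs : ∀ ω, Run ω P 0 (inputStore input) (t ω) (s ω)) {T : ℕ} (hT : ∀ ω, t ω ≤ T) :
    (P.ntm k).HaltsWithin input (T + 1) ∧
      ((P.ntm k).Accepts input ↔ ∃ ω, (s ω 0).head? = some (.bit true)) := by
  have hinit : (P.ntm k).init input = ⟨.inl (P.frag k).start, tapes k (inputStore input)⟩ := by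
    unfold NTM.init tapes inputStore
    congr 1
    funext i
    by_cases h : i.val < m
    · rw [dif_pos h, dif_pos h]
      rfl
    · rw [dif_neg h, dif_neg h]
      rfl
  -- the last two configurations of the branch given by `ω`
  have key : ∀ ω, (∃ T', conf P k ω ((P.ntm k).init input) (t ω + 1) =
        some ⟨.inr (some (decide ((s ω 0).head? = some (.bit true)))), T'⟩) ∧
      conf P k ω ((P.ntm k).init input) (t ω + 2) = none := by
    intro ω
    have h₁ : conf P k ω ((P.ntm k).init input) (t ω) = some ⟨.inr none, tapes k (s ω)⟩ :=
      conf_of_exits ((hs ω).exits hk) (by rw [hinit]; rfl)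
    have h₂ : conf P k ω ((P.ntm k).init input) (t ω + 1) =
        some ⟨.inr (some (decide ((s ω 0).head? = some (.bit true)))),
          fun j => NTM.act (tapes k (s ω) j) (nop (heads (tapes k (s ω))) j)⟩ := by
      simp only [conf, h₁, Option.bind_some, ntmNext, Option.map_some, hd_heads_tapes (s ω) hk0]
    refine ⟨⟨_, h₂⟩, ?_⟩
    rw [conf, h₂]
    rfl
  refine ⟨fun t' c hc => ?_, ?_⟩
  · obtain ⟨ω, hω⟩ := (reaches_iff P _ _ _).1 hc
    have := hT ω
    by_contra hlt
    have := conf_eq_none (show t ω + 2 ≤ t' by omega) (key ω).2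
    rw [this] at hω
    cases hω
  · constructor
    · rintro ⟨t', c, hc, hhalt, hacc⟩
      obtain ⟨ω, hω⟩ := (reaches_iff P _ _ _).1 hc
      refine ⟨ω, ?_⟩
      obtain ⟨⟨T', h₁⟩, h₂⟩ := key ω
      rcases lt_trichotomy t' (t ω + 1) with hlt | rfl | hlt
      · exfalso
        -- a configuration before the last one has a successor
        have : conf P k ω ((P.ntm k).init input) (t' + 1) ≠ none := by
          intro h
          rw [conf_eq_none (show t' + 1 ≤ t ω + 1 by omega) h] at h₁
          cases h₁
        obtain ⟨d, hd⟩ := Option.ne_none_iff_exists'.1 this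
        simp only [conf, hω, Option.bind_some, Option.map_eq_some_iff] at hd
        obtain ⟨a, ha, rfl⟩ := hd
        exact hhalt ⟨a.1, fun j => NTM.act (c.tape j) (a.2 j)⟩ ⟨a, ⟨ω t', ha⟩, rfl, fun _ => rfl⟩
      · rw [h₁] at hω
        cases hω
        have := Sum.inr.inj (Set.mem_singleton_iff.1 hacc)
        simpa using this
      · rw [conf_eq_none (show t ω + 2 ≤ t' by omega) h₂] at hω
        cases hω
    · rintro ⟨ω, hacc⟩
      obtain ⟨⟨T', h₁⟩, h₂⟩ := key ω
      refine ⟨t ω + 1, _, (reaches_iff P _ _ _).2 ⟨ω, h₁⟩, ?_, ?_⟩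
      · rintro c' ⟨a, ⟨o, ho⟩, -⟩
        cases ho
      · simp only [hacc, decide_true]
        exact Set.mem_singleton _

end Prog

/-! ### Programs on lists of words -/

namespace Prog

/-- Add `1` to all stack numbers. -/
def shift : Prog → Prog
  | skip => skip
  | push i a => push (i + 1) a
  | guess i => guess (i + 1)
  | seq P Q => seq P.shift Q.shift
  | case i f => case (i + 1) fun o => (f o).shift
  | loop i f => loop (i + 1) fun a => (f a).shift

/-- Put a new stack in front. -/
def scons (x : List Symb) (s : Store) : Store
  | 0 => x
  | i + 1 => s i

theorem update_scons_zero (x y : List Symb) (s : Store) :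
    Function.update (scons x s) 0 y = scons y s := by
  funext i
  cases i <;> simp [scons, Function.update]

theorem update_scons_succ (x y : List Symb) (s : Store) (i : ℕ) :
    Function.update (scons x s) (i + 1) y = scons x (Function.update s i y) := by
  funext j
  cases j <;> simp [scons, Function.update]

theorem Run.shift {ω P τ s τ' s'} (H : Run ω P τ s τ' s') (x : List Symb) :
    Run ω P.shift τ (scons x s) τ' (scons x s') := by
  induction H with
  | skip τ s => exact .skip _ _
  | push i a τ s =>
    rw [← update_scons_succ]
    exact .push (i + 1) a τ (scons x s)
  | guess i τ s =>
    rw [← update_scons_succ]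
    exact .guess (i + 1) τ (scons x s)
  | seq _ _ ih₁ ih₂ => exact .seq ih₁ ih₂
  | @case i f τ s τ' s' _ ih =>
    rw [← update_scons_succ] at ih
    exact Run.case (i := i + 1) (s := scons x s) ih
  | loop_nil hs => exact .loop_nil hs
  | loop_cons hs _ _ ih₁ ih₂ =>
    rw [← update_scons_succ] at ih₁
    exact .loop_cons hs ih₁ ih₂

theorem GuessFree.shift {P : Prog} (h : P.GuessFree) : P.shift.GuessFree := by
  induction P with
  | skip => trivial
  | push i a => trivial
  | guess i => exact h
  | seq P Q hP hQ => exact ⟨hP h.1, hQ h.2⟩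
  | case i f ih => exact fun o => ih o (h o)
  | loop i f ih => exact fun o => ih o (h o)

/-- In each unit of time, a stack grows by at most one letter. -/
theorem Run.length_le {ω P τ s τ' s'} (H : Run ω P τ s τ' s') (i : ℕ) :
    (s' i).length + τ ≤ (s i).length + τ' := by
  have upd : ∀ (s : Store) (j : ℕ) (l : List Symb) (n : ℕ), l.length ≤ (s j).length + n →
      (Function.update s j l i).length ≤ (s i).length + n := by
    intro s j l n h
    by_cases hij : i = j
    · subst hij
      simpa using h
    · simp [Function.update_of_ne hij]
  induction H with
  | skip τ s => omega
  | push j a τ s =>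
    have := upd s j (a :: s j) 1 (by simp)
    omega
  | guess j τ s =>
    have := upd s j ((ω (τ + 1)).toList ++ s j) 1 (by
      cases ω (τ + 1) <;> simp)
    omega
  | seq _ _ ih₁ ih₂ => omega
  | @case j f τ s τ' s' _ ih =>
    have := upd s j (s j).tail 0 (by simp)
    omega
  | loop_nil hs => omega
  | @loop_cons j f τ s a l τ' s' τ'' s'' hs _ _ ih₁ ih₂ =>
    have := upd s j l 0 (by simp [hs])
    omega

/-- The store that starts with the given stacks. -/
def st : List (List Symb) → Store
  | [] => fun _ => []
  | x :: l => scons x (st l)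

@[simp] theorem st_nil (i : ℕ) : st [] i = [] := rfl

@[simp] theorem st_cons_zero (x l) : st (x :: l) 0 = x := rfl

@[simp] theorem st_cons_succ (x l) (i : ℕ) : st (x :: l) (i + 1) = st l i := rfl

theorem st_eq_getD (l : List (List Symb)) (i : ℕ) : st l i = l.getD i [] := by
  induction l generalizing i with
  | nil => rfl
  | cons x l ih =>
    cases i with
    | zero => rfl
    | succ i => simpa using ih i

theorem st_of_le {l : List (List Symb)} {i : ℕ} (h : l.length ≤ i) : st l i = [] := by
  rw [st_eq_getD, List.getD_eq_default _ _ h]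

theorem update_st_length (l : List (List Symb)) (x : List Symb) :
    Function.update (st l) l.length x = st (l ++ [x]) := by
  induction l with
  | nil =>
    funext i
    cases i <;> simp [Function.update]
  | cons y l ih => rw [List.length_cons, st, update_scons_succ, ih]; rfl

/-- The total length of the words of a list. -/
def total (l : List (List Symb)) : ℕ := (l.map List.length).sum

theorem length_st_le (l : List (List Symb)) (i : ℕ) : (st l i).length ≤ total l := by
  induction l generalizing i with
  | nil => simp
  | cons x l ih =>
    cases i with
    | zero => simp [total]
    | succ i => exact (ih i).trans (by simp [total])

@[simp] theorem total_nil : total [] = 0 := rfl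

@[simp] theorem total_cons (x l) : total (x :: l) = x.length + total l := by simp [total]

@[simp] theorem total_append (l l') : total (l ++ l') = total l + total l' := by simp [total]

/-- `Does P l l' T`: on the words `l`, the program `P` computes the words `l'` within time `T`,
without guesses. -/
def Does (P : Prog) (l l' : List (List Symb)) (T : ℕ) : Prop :=
  ∃ t ≤ T, ∀ ω τ, Run ω P τ (st l) (τ + t) (st l')

theorem Does.mono {P l l' T T'} (h : Does P l l' T) (hT : T ≤ T') : Does P l l' T' :=
  let ⟨t, ht, H⟩ := h
  ⟨t, ht.trans hT, H⟩

theorem Does.seq {P Q l l' l'' T T'} (h : Does P l l' T) (h' : Does Q l' l'' T') :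
    Does (seq P Q) l l'' (T + T') := by
  obtain ⟨t, ht, H⟩ := h
  obtain ⟨t', ht', H'⟩ := h'
  refine ⟨t + t', add_le_add ht ht', fun ω τ => ?_⟩
  rw [← add_assoc]
  exact (H ω τ).seq (H' ω _)

theorem Does.shift {P l l' T} (h : Does P l l' T) (x : List Symb) :
    Does P.shift (x :: l) (x :: l') T :=
  let ⟨t, ht, H⟩ := h
  ⟨t, ht, fun ω τ => (H ω τ).shift x⟩

/-- Run a program on all stacks but the first `n`. -/
def shiftBy : ℕ → Prog → Prog
  | 0, P => P
  | n + 1, P => (shiftBy n P).shift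

theorem GuessFree.shiftBy {P : Prog} (h : P.GuessFree) (n : ℕ) : (P.shiftBy n).GuessFree := by
  induction n with
  | zero => exact h
  | succ n ih => exact ih.shift

theorem Does.shiftBy {P l l' T} (h : Does P l l' T) (p : List (List Symb)) {n : ℕ}
    (hn : p.length = n) : Does (P.shiftBy n) (p ++ l) (p ++ l') T := by
  subst hn
  induction p with
  | nil => exact h
  | cons x p ih => exact ih.shift x

theorem Does.total_le {P l l' T} (h : Does P l l' T) : total l' ≤ l'.length * (total l + T) := by
  obtain ⟨t, ht, H⟩ := h
  have key : ∀ i, (st l' i).length ≤ total l + T := fun i => by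
    have h₁ := (H (fun _ => none) 0).length_le i
    have h₂ := length_st_le l i
    omega
  unfold total
  rw [← smul_eq_mul, ← List.length_map (f := List.length)]
  refine List.sum_le_card_nsmul _ _ fun n hn => ?_
  obtain ⟨x, hx, rfl⟩ := List.mem_map.1 hn
  obtain ⟨i, hi, rfl⟩ := List.getElem_of_mem hx
  have := key i
  rwa [st_eq_getD, List.getD_eq_getElem _ _ hi] at this

/-! ### Copying and moving words -/

/-- Move the letters of stack `i` one by one to stack `j`. -/
def pour (i j : ℕ) : Prog := loop i fun a => push j a

/-- Move the letters of stack `i` one by one to both stacks `j` and `k`. -/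
def pour₂ (i j k : ℕ) : Prog := loop i fun a => seq (push j a) (push k a)

/-- Empty stack `i`. -/
def clear (i : ℕ) : Prog := loop i fun _ => skip

/-- Copy stack `i` to stack `j` with the help of stack `k`. -/
def copy (i j k : ℕ) : Prog := seq (pour i k) (pour₂ k i j)

theorem run_pour (ω τ) {i j : ℕ} (hij : i ≠ j) (s : Store) :
    Run ω (pour i j) τ s (τ + (3 * (s i).length + 1))
      (Function.update (Function.update s i []) j ((s i).reverse ++ s j)) := by
  generalize hl : s i = l
  induction l generalizing s τ with
  | nil =>
    have e : Function.update s i [] = s := by rw [← hl, Function.update_eq_self]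
    simpa [e, pour] using Run.loop_nil (f := fun a => push j a) hl
  | cons a l ih =>
    refine .loop_cons hl (.push j a _ _) ?_
    have := ih (τ + 1 + 2) (Function.update (Function.update s i l) j
      (a :: Function.update s i l j)) (by simp [Function.update, hij])
    convert this using 1
    · rfl
    · simp only [List.length_cons]; ring
    · funext n
      by_cases hj : n = j
      · subst hj; simp [Function.update, hij.symm]
      · by_cases hi : n = i <;> simp [Function.update, hi, hj, hij]

theorem run_pour₂ (ω τ) {i j k : ℕ} (hij : i ≠ j) (hik : i ≠ k) (hjk : j ≠ k) (s : Store) :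
    Run ω (pour₂ i j k) τ s (τ + (5 * (s i).length + 1))
      (Function.update (Function.update (Function.update s i []) j ((s i).reverse ++ s j)) k
        ((s i).reverse ++ s k)) := by
  generalize hl : s i = l
  induction l generalizing s τ with
  | nil =>
    have e : Function.update s i [] = s := by rw [← hl, Function.update_eq_self]
    simpa [e, pour₂] using Run.loop_nil (f := fun a => seq (push j a) (push k a)) hl
  | cons a l ih =>
    refine .loop_cons hl (.seq (.push j a _ _) (.push k a _ _)) ?_
    have := ih (τ + 1 + 2 + 2) _ (show Function.update (Function.update (Function.update s i l) j
      (a :: Function.update s i l j)) k (a :: Function.update (Function.update s i l) j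
        (a :: Function.update s i l j) k) i = l by simp [Function.update, hij, hik])
    convert this using 1
    · rfl
    · simp only [List.length_cons]; ring
    · funext n
      by_cases hk : n = k
      · subst hk; simp [Function.update, hik.symm, hjk.symm]
      · by_cases hj : n = j
        · subst hj; simp [Function.update, hij.symm, hk]
        · by_cases hi : n = i <;> simp [Function.update, hi, hj, hk, hij, hik]

theorem run_clear (ω τ) (i : ℕ) (s : Store) :
    Run ω (clear i) τ s (τ + (2 * (s i).length + 1)) (Function.update s i []) := by
  generalize hl : s i = l
  induction l generalizing s τ with
  | nil =>
    have e : Function.update s i [] = s := by rw [← hl, Function.update_eq_self]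
    simpa [e, clear] using Run.loop_nil (f := fun _ => skip) hl
  | cons a l ih =>
    refine .loop_cons hl (.skip _ _) ?_
    have := ih (τ + 1 + 1) (Function.update s i l) (by simp)
    convert this using 1
    · rfl
    · simp only [List.length_cons]; ring
    · simp

theorem run_copy (ω τ) {i j k : ℕ} (hij : i ≠ j) (hik : i ≠ k) (hjk : j ≠ k) (s : Store)
    (hj : s j = []) (hk : s k = []) :
    Run ω (copy i j k) τ s (τ + (8 * (s i).length + 2)) (Function.update s j (s i)) := by
  refine .seq (run_pour ω τ hik s) ?_
  convert run_pour₂ ω _ hik.symm hjk.symm hij _ using 1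
  · simp [hk]; ring
  · funext n
    by_cases hn : n = j
    · subst hn; simp [Function.update, hij.symm, hjk, hj, hk]
    · by_cases hn' : n = i
      · subst hn'; simp [Function.update, hik, hn, hk]
      · by_cases hn'' : n = k
        · subst hn''; simp [Function.update, hn, hn', hk]
        · simp [Function.update, hn, hn', hn'']

/-- Remove the first stack, where `n` further stacks are in use. -/
def del : ℕ → Prog
  | 0 => clear 0
  | n + 1 => seq (clear 0) (seq (pour 1 (n + 2)) (seq (pour (n + 2) 0) (del n).shift))

theorem does_del (n : ℕ) (x : List Symb) (l : List (List Symb)) (hl : l.length = n) :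
    Does (del n) (x :: l) l (8 * (total (x :: l) + n) + 1) := by
  induction n generalizing x l with
  | zero =>
    obtain rfl := List.length_eq_zero_iff.1 hl
    refine ⟨2 * x.length + 1, by simp; omega, fun ω τ => ?_⟩
    convert run_clear ω τ 0 (st [x]) using 1
    · rfl
    · rfl
    · rw [show st [x] = scons x (st []) from rfl, update_scons_zero]
      funext i
      cases i <;> rfl
  | succ n ih =>
    obtain ⟨y, l, rfl⟩ : ∃ y l', l = y :: l' := List.exists_cons_of_length_eq_add_one hl
    obtain rfl : l.length = n := by simpa using hl
    have hs : st l l.length = [] := st_of_le le_rfl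
    have h₀ : Does (clear 0) (x :: y :: l) ([] :: y :: l) (2 * x.length + 1) :=
      ⟨_, le_rfl, fun ω τ => by
        have := run_clear ω τ 0 (st (x :: y :: l))
        rwa [st, update_scons_zero] at this⟩
    have h₁ : Does (pour 1 (l.length + 2)) ([] :: y :: l) ([] :: [] :: (l ++ [y.reverse]))
        (3 * y.length + 1) := ⟨_, le_rfl, fun ω τ => by
      have := run_pour ω τ (i := 1) (j := l.length + 2) (by omega) (st ([] :: y :: l))
      have e : Function.update (Function.update (st ([] :: y :: l)) 1 []) (l.length + 2)
          ((st ([] :: y :: l) 1).reverse ++ st ([] :: y :: l) (l.length + 2)) =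
          st ([] :: [] :: (l ++ [y.reverse])) := by
        simp only [st_cons_succ, st_cons_zero, hs, List.append_nil]
        simp only [st, update_scons_succ, update_scons_zero, ← update_st_length]
      rwa [e] at this⟩
    have h₂ : Does (pour (l.length + 2) 0) ([] :: [] :: (l ++ [y.reverse])) (y :: [] :: l)
        (3 * y.length + 1) := ⟨_, le_rfl, fun ω τ => by
      have := run_pour ω τ (i := l.length + 2) (j := 0) (by omega)
        (st ([] :: [] :: (l ++ [y.reverse])))
      have e₁ : st (l ++ [y.reverse]) l.length = y.reverse := by
        simp [st_eq_getD]
      have e₂ : Function.update (st (l ++ [y.reverse])) l.length [] = st l := by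
        rw [← update_st_length, Function.update_idem, ← hs, Function.update_eq_self]
      have e : Function.update (Function.update (st ([] :: [] :: (l ++ [y.reverse])))
          (l.length + 2) []) 0 ((st ([] :: [] :: (l ++ [y.reverse])) (l.length + 2)).reverse ++
            st ([] :: [] :: (l ++ [y.reverse])) 0) = st (y :: [] :: l) := by
        simp only [st_cons_succ, st_cons_zero, e₁, List.reverse_reverse, List.append_nil]
        simp only [st, update_scons_succ, update_scons_zero, e₂]
      rw [e] at this
      simpa only [st_cons_succ, e₁, List.length_reverse] using this⟩
    refine (h₀.seq (h₁.seq (h₂.seq ((ih [] l rfl).shift y)))).mono ?_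
    simp
    omega

/-- With `m` stacks in use, append copies of the stacks with the numbers `ρ`. -/
def copies : ℕ → List ℕ → Prog
  | _, [] => skip
  | m, i :: ρ => seq (copy i m (m + 1)) (copies (m + 1) ρ)

/-- Remove the first `m` stacks, where `n` further stacks are in use. -/
def dels : ℕ → ℕ → Prog
  | 0, _ => skip
  | m + 1, n => seq (del (m + n)) (dels m n)

/-- With `m` stacks in use, replace them by the stacks with the numbers `ρ`. -/
def wire (m : ℕ) (ρ : List ℕ) : Prog := seq (copies m ρ) (dels m ρ.length)

theorem does_skip (l) : Does skip l l 1 := ⟨1, le_rfl, fun _ _ => .skip _ _⟩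

theorem does_copies (ρ : List ℕ) (l : List (List Symb)) (hρ : ∀ i ∈ ρ, i < l.length) :
    Does (copies l.length ρ) l (l ++ ρ.map (st l)) (8 * 3 ^ ρ.length * (total l + 1) + 1) := by
  induction ρ generalizing l with
  | nil => simpa [copies] using (does_skip l).mono (Nat.le_add_left 1 _)
  | cons i ρ ih =>
    have hi : i < l.length := hρ i (by simp)
    have h₁ : Does (copy i l.length (l.length + 1)) l (l ++ [st l i])
        (8 * (st l i).length + 2) := ⟨_, le_rfl, fun ω τ => by
      have := run_copy ω τ (i := i) (j := l.length) (k := l.length + 1) (by omega) (by omega)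
        (by omega) (st l) (st_of_le le_rfl) (st_of_le (Nat.le_succ _))
      rwa [update_st_length] at this⟩
    have h₂ := ih (l ++ [st l i]) (fun j hj => by
      have := hρ j (by simp [hj])
      simp
      omega)
    have e : ρ.map (st (l ++ [st l i])) = ρ.map (st l) := List.map_congr_left fun j hj => by
      have : j < l.length := hρ j (by simp [hj])
      rw [st_eq_getD, List.getD_append _ _ _ _ this, st_eq_getD]
    rw [e, List.length_append, List.length_singleton, List.append_assoc] at h₂
    refine (h₁.seq h₂).mono ?_
    have h₃ := length_st_le l i
    have h₄ : 1 ≤ 3 ^ ρ.length := Nat.one_le_pow _ _ (by norm_num)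
    simp only [total_append, total_cons, total_nil, List.length_cons, pow_succ]
    nlinarith

theorem does_dels (p r : List (List Symb)) :
    Does (dels p.length r.length) (p ++ r) r
      (p.length * (8 * (total p + total r + (p.length + r.length)) + 1) + 1) := by
  induction p with
  | nil => exact (does_skip r).mono (Nat.le_add_left 1 _)
  | cons x p ih =>
    refine ((does_del (p.length + r.length) x (p ++ r) (by simp)).seq ih).mono ?_
    simp only [total_append, total_cons, List.length_cons]
    nlinarith

theorem does_wire (m : ℕ) (ρ : List ℕ) (hρ : ∀ i ∈ ρ, i < m) :
    ∃ c, ∀ l : List (List Symb), l.length = m →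
      Does (wire m ρ) l (ρ.map (st l)) (c * (total l + 1)) := by
  refine ⟨8 * 3 ^ ρ.length + 1 + m * (8 * (1 + ρ.length + (m + ρ.length)) + 1) + 1, ?_⟩
  rintro l rfl
  have h := does_dels l (ρ.map (st l))
  rw [List.length_map] at h
  refine ((does_copies ρ l hρ).seq h).mono ?_
  have : total (ρ.map (st l)) ≤ ρ.length * total l := by
    unfold total
    rw [← smul_eq_mul, List.map_map, ← List.length_map (f := List.length ∘ st l)]
    refine List.sum_le_card_nsmul _ _ fun n hn => ?_
    obtain ⟨i, hi, rfl⟩ := List.mem_map.1 hn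
    exact length_st_le l i
  have h₂ : l.length * (8 * (total l + total (ρ.map (st l)) + (l.length + ρ.length)) + 1) ≤
      l.length * (8 * (1 + ρ.length + (l.length + ρ.length)) + 1) * (total l + 1) := by
    rw [mul_assoc]
    refine Nat.mul_le_mul_left _ ?_
    nlinarith [Nat.zero_le (l.length * total l), Nat.zero_le (ρ.length * total l)]
  nlinarith

theorem guessFree_del (n : ℕ) : (del n).GuessFree := by
  induction n with
  | zero => exact fun _ => trivial
  | succ n ih => exact ⟨fun _ => trivial, fun _ => trivial, fun _ => trivial, ih.shift⟩

theorem guessFree_dels (m n : ℕ) : (dels m n).GuessFree := by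
  induction m with
  | zero => trivial
  | succ m ih => exact ⟨guessFree_del _, ih⟩

theorem guessFree_copies (m : ℕ) (ρ : List ℕ) : (copies m ρ).GuessFree := by
  induction ρ generalizing m with
  | nil => trivial
  | cons i ρ ih => exact ⟨⟨fun _ => trivial, fun _ => ⟨trivial, trivial⟩⟩, ih _⟩

theorem guessFree_wire (m : ℕ) (ρ : List ℕ) : (wire m ρ).GuessFree :=
  ⟨guessFree_copies _ _, guessFree_dels _ _⟩

theorem st_append_nil (l : List (List Symb)) : st (l ++ [[]]) = st l := by
  rw [← update_st_length, ← st_of_le (le_refl l.length), Function.update_eq_self]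

theorem map_st_range (p l q : List (List Symb)) :
    (List.range' p.length l.length).map (st (p ++ (l ++ q))) = l := by
  refine List.ext_getElem (by simp) fun i hi _ => ?_
  have : i < l.length := by simpa using hi
  simp [st_eq_getD, List.getElem?_append_right, List.getElem?_append_left this,
    List.getElem?_eq_getElem this]

theorem Does.case {f x l l' T} (h : Does (f x.head?) (x.tail :: l) l' T) :
    Does (case 0 f) (x :: l) l' (T + 1) := by
  obtain ⟨t, ht, H⟩ := h
  refine ⟨t + 1, by omega, fun ω τ => .case ?_⟩
  have := H ω (τ + 1)
  rw [st, update_scons_zero]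
  rwa [show τ + (t + 1) = τ + 1 + t by ring]

end Prog

/-! ### Functions computable in polynomial time -/

/-- A type whose elements are encoded by a fixed number of words. -/
class Coded (α : Type) where
  width : ℕ
  enc : α → List (List Symb)
  length_enc : ∀ a, (enc a).length = width

namespace Coded

instance : Coded (List Symb) := ⟨1, fun l => [l], fun _ => rfl⟩

instance : Coded Bool := ⟨1, fun b => [[.bit b]], fun _ => rfl⟩

instance {α β : Type} [Coded α] [Coded β] : Coded (α × β) :=
  ⟨width α + width β, fun p => enc p.1 ++ enc p.2, fun p => by simp [length_enc]⟩

/-- The total length of the words that encode an element. -/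
def size {α : Type} [Coded α] (a : α) : ℕ := Prog.total (enc a)

@[simp] theorem size_word (l : List Symb) : size l = l.length := by
  simp [size, enc]

@[simp] theorem size_bool (b : Bool) : size b = 1 := by
  simp [size, enc]

@[simp] theorem size_prod {α β : Type} [Coded α] [Coded β] (p : α × β) :
    size p = size p.1 + size p.2 := by
  simp [size, enc]

end Coded

open Coded

theorem Polynomial.eval_nat_mono (p : Polynomial ℕ) : Monotone fun x => p.eval x := by
  intro x y h
  simp only [Polynomial.eval_eq_sum_range]
  gcongr

/-- `g` is bounded by a polynomial in the size of the argument. -/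
def PolyBdd {α : Type} [Coded α] (g : α → ℕ) : Prop :=
  ∃ q : Polynomial ℕ, ∀ a, g a ≤ q.eval (size a)

namespace PolyBdd

variable {α : Type} [Coded α]

theorem mono {f g : α → ℕ} (hg : PolyBdd g) (h : ∀ a, f a ≤ g a) : PolyBdd f :=
  let ⟨q, hq⟩ := hg
  ⟨q, fun a => (h a).trans (hq a)⟩

theorem const (n : ℕ) : PolyBdd fun _ : α => n := ⟨.C n, fun a => by simp⟩

theorem size : PolyBdd fun a : α => size a := ⟨.X, fun a => by simp⟩

theorem add {f g : α → ℕ} (hf : PolyBdd f) (hg : PolyBdd g) : PolyBdd fun a => f a + g a :=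
  let ⟨p, hp⟩ := hf
  let ⟨q, hq⟩ := hg
  ⟨p + q, fun a => by simpa using add_le_add (hp a) (hq a)⟩

theorem mul {f g : α → ℕ} (hf : PolyBdd f) (hg : PolyBdd g) : PolyBdd fun a => f a * g a :=
  let ⟨p, hp⟩ := hf
  let ⟨q, hq⟩ := hg
  ⟨p * q, fun a => by simpa using Nat.mul_le_mul (hp a) (hq a)⟩

theorem eval {f : α → ℕ} (hf : PolyBdd f) (p : Polynomial ℕ) : PolyBdd fun a => p.eval (f a) :=
  let ⟨q, hq⟩ := hf
  ⟨p.comp q, fun a => by simpa using p.eval_nat_mono (hq a)⟩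

end PolyBdd

/-- `f` is computed in polynomial time by a stack program: started with the words that encode the
argument on the first stacks and with all other stacks empty, the program ends with the words that
encode the value on the first stacks and with all other stacks empty. -/
def PolyTime {α β : Type} [Coded α] [Coded β] (f : α → β) : Prop :=
  ∃ P : Prog, P.GuessFree ∧ ∃ T : α → ℕ, PolyBdd T ∧ ∀ a, P.Does (enc a) (enc (f a)) (T a)

namespace PolyTime

variable {α β γ δ : Type} [Coded α] [Coded β] [Coded γ] [Coded δ]

theorem size_bdd {f : α → β} (hf : PolyTime f) : PolyBdd fun a => size (f a) := by
  obtain ⟨P, -, T, hT, h⟩ := hf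
  refine ((PolyBdd.const (width β)).mul (PolyBdd.size.add hT)).mono fun a => ?_
  have := (h a).total_le
  rwa [length_enc] at this

theorem _root_.PolyBdd.comp {g : β → ℕ} {f : α → β} (hg : PolyBdd g) (hf : PolyTime f) :
    PolyBdd fun a => g (f a) :=
  let ⟨q, hq⟩ := hg
  (hf.size_bdd.eval q).mono fun a => hq (f a)

theorem comp {g : β → γ} {f : α → β} (hg : PolyTime g) (hf : PolyTime f) :
    PolyTime fun a => g (f a) := by
  obtain ⟨Q, hQ, T', hT', h'⟩ := hg
  have hT'' := hT'.comp hf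
  obtain ⟨P, hP, T, hT, h⟩ := hf
  exact ⟨.seq P Q, ⟨hP, hQ⟩, _, hT.add hT'', fun a => (h a).seq (h' (f a))⟩

/-- Rearranging words. -/
theorem of_wire {f : α → β} (ρ : List ℕ) (hρ : ∀ i ∈ ρ, i < width α)
    (h : ∀ a, ρ.map (Prog.st (enc a)) = enc (f a)) : PolyTime f := by
  obtain ⟨c, hc⟩ := Prog.does_wire (width α) ρ hρ
  refine ⟨Prog.wire (width α) ρ, Prog.guessFree_wire _ _, fun a => c * (size a + 1),
    (PolyBdd.const c).mul (PolyBdd.size.add (.const 1)), fun a => ?_⟩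
  rw [← h a]
  exact hc (enc a) (length_enc a)

theorem map_st_range (p l q : List (List Symb)) {m n : ℕ} (hm : p.length = m)
    (hn : l.length = n) : (List.range' m n).map (Prog.st (p ++ (l ++ q))) = l := by
  subst hm hn
  exact Prog.map_st_range p l q

protected theorem id : PolyTime fun a : α => a :=
  ⟨.skip, trivial, fun _ => 1, .const 1, fun _ => Prog.does_skip _⟩

protected theorem fst : PolyTime fun p : α × β => p.1 :=
  of_wire (List.range' 0 (width α)) (fun i hi => by
    simp [List.mem_range', width] at hi ⊢; omega)
    fun p => map_st_range [] (enc p.1) (enc p.2) rfl (length_enc _)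

protected theorem snd : PolyTime fun p : α × β => p.2 :=
  of_wire (List.range' (width α) (width β)) (fun i hi => by
    simp [List.mem_range', width] at hi ⊢; omega)
    fun p => by
      have := map_st_range (enc p.1) (enc p.2) [] (length_enc _) (length_enc _)
      rwa [List.append_nil] at this

theorem dup : PolyTime fun a : α => (a, a) :=
  of_wire (List.range' 0 (width α) ++ List.range' 0 (width α)) (fun i hi => by
    simp [List.mem_range'] at hi ⊢; omega)
    fun a => by
      have := map_st_range [] (enc a) [] rfl (length_enc a)
      rw [List.append_nil] at this
      rw [List.map_append]
      exact congrArg₂ (· ++ ·) this this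

protected theorem swap : PolyTime fun p : α × β => (p.2, p.1) :=
  of_wire (List.range' (width α) (width β) ++ List.range' 0 (width α)) (fun i hi => by
    simp [List.mem_range', width] at hi ⊢; omega)
    fun p => by
      have h₁ := map_st_range (enc p.1) (enc p.2) [] (length_enc _) (length_enc _)
      have h₂ := map_st_range [] (enc p.1) (enc p.2) rfl (length_enc _)
      rw [List.append_nil] at h₁
      rw [List.map_append]
      exact congrArg₂ (· ++ ·) h₁ h₂

theorem prodMap_right {f : α → β} (hf : PolyTime f) :
    PolyTime fun p : γ × α => (p.1, f p.2) := by
  obtain ⟨P, hP, T, hT, h⟩ := hf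
  exact ⟨P.shiftBy (width γ), hP.shiftBy _, _, hT.comp .snd,
    fun p => (h p.2).shiftBy _ (length_enc _)⟩

theorem pair {f : α → β} {g : α → γ} (hf : PolyTime f) (hg : PolyTime g) :
    PolyTime fun a => (f a, g a) :=
  PolyTime.swap.comp (hf.prodMap_right.comp (PolyTime.swap.comp (hg.prodMap_right.comp dup)))

/-- Functions on words that are given by a program without an effect on other stacks. -/
theorem of_word {f : List Symb → List Symb} (P : Prog) (hP : P.GuessFree) (t : ℕ)
    (h : ∀ l, P.Does [l] [f l] t) : PolyTime f :=
  ⟨P, hP, fun _ => t, .const t, h⟩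

protected theorem cons {f : α → List Symb} (a : Symb) (hf : PolyTime f) :
    PolyTime fun x => a :: f x :=
  (of_word (f := fun l => a :: l) (.push 0 a) trivial 2 fun l => ⟨2, le_rfl, fun ω τ => by
    have := Prog.Run.push (ω := ω) 0 a τ (Prog.st [l])
    rwa [show Prog.st [l] = Prog.scons l (Prog.st []) from rfl,
      Prog.update_scons_zero] at this⟩).comp hf

protected theorem tail {f : α → List Symb} (hf : PolyTime f) : PolyTime fun x => (f x).tail :=
  (of_word (f := List.tail) (.case 0 fun _ => .skip) (fun _ => trivial) 2
    fun l => (Prog.does_skip [l.tail]).case).comp hf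

protected theorem nil : PolyTime fun _ : α => ([] : List Symb) := by
  refine ⟨Prog.dels (width α) 1, Prog.guessFree_dels _ _,
    fun a => width α * (8 * (size a + 0 + (width α + 1)) + 1) + 1,
    ((PolyBdd.const _).mul (((PolyBdd.const 8).mul
      ((PolyBdd.size.add (.const _)).add (.const _))).add (.const _))).add (.const _), fun a => ?_⟩
  have := Prog.does_dels (enc a) [[]]
  rw [length_enc] at this
  unfold Prog.Does at this
  rw [Prog.st_append_nil] at this
  simpa [Prog.Does, size, enc] using this

/-- Branching on the first letter of a word. -/
theorem head_case {h : α → List Symb} {F : Option Symb → α → β} (hh : PolyTime h)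
    (hF : ∀ o, PolyTime (F o)) : PolyTime fun a => F (h a).head? a := by
  suffices H : PolyTime fun p : List Symb × α => F p.1.head? p.2 from H.comp (hh.pair .id)
  have hF' : ∀ o, PolyTime fun p : List Symb × α => F o p.2 := fun o => (hF o).comp .snd
  choose P hP T hT hd using hF'
  refine ⟨.case 0 P, hP, fun p => (∑ o, T o (p.1.tail, p.2)) + 1, ?_, ?_⟩
  · refine PolyBdd.add ?_ (.const 1)
    have : PolyTime fun p : List Symb × α => (p.1.tail, p.2) :=
      (PolyTime.fst.tail).pair PolyTime.snd
    have hT' := fun o => (hT o).comp this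
    choose q hq using hT'
    exact ⟨∑ o, q o, fun p => by
      rw [Polynomial.eval_finsetSum]
      exact Finset.sum_le_sum fun o _ => hq o p⟩
  · intro p
    exact ((hd p.1.head? (p.1.tail, p.2)).mono (Finset.single_le_sum
      (f := fun o => T o (p.1.tail, p.2)) (fun _ _ => Nat.zero_le _) (Finset.mem_univ _))).case

theorem const_bool (b : Bool) : PolyTime fun _ : α => b := by
  obtain ⟨P, hP, T, hT, h⟩ := (PolyTime.nil (α := α)).cons (.bit b)
  exact ⟨P, hP, T, hT, h⟩

protected theorem cond {c : α → Bool} {f g : α → β} (hc : PolyTime c) (hf : PolyTime f)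
    (hg : PolyTime g) :
    PolyTime fun a => bif c a then f a else g a := by
  have hc' : PolyTime fun a => [Symb.bit (c a)] := by
    obtain ⟨P, hP, T, hT, h⟩ := hc
    exact ⟨P, hP, T, hT, h⟩
  have := head_case (F := fun o a => bif decide (o = some (.bit true)) then f a else g a) hc'
    (fun o => by
      cases decide (o = some (.bit true))
      · exact hg
      · exact hf)
  convert this using 2 with a
  cases c a <;> rfl

protected theorem not {c : α → Bool} (hc : PolyTime c) : PolyTime fun a => !c a := by
  convert hc.cond (const_bool false) (const_bool true) using 2 with a
  cases c a <;> rfl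

protected theorem and {c d : α → Bool} (hc : PolyTime c) (hd : PolyTime d) :
    PolyTime fun a => c a && d a := by
  convert hc.cond hd (const_bool false) using 2 with a
  cases c a <;> rfl

protected theorem or {c d : α → Bool} (hc : PolyTime c) (hd : PolyTime d) :
    PolyTime fun a => c a || d a := by
  convert hc.cond (const_bool true) hd using 2 with a
  cases c a <;> rfl

protected theorem xor {c d : α → Bool} (hc : PolyTime c) (hd : PolyTime d) :
    PolyTime fun a => Bool.xor (c a) (d a) := by
  convert hc.cond hd.not hd using 2 with a
  cases c a <;> simp

/-- A test of the first letter of a word. -/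
theorem head_test {h : α → List Symb} (hh : PolyTime h) (F : Option Symb → Bool) :
    PolyTime fun a => F (h a).head? :=
  head_case (F := fun o _ => F o) hh fun o => const_bool (F o)

theorem cons_bit {c : α → Bool} {f : α → List Symb} (hc : PolyTime c) (hf : PolyTime f) :
    PolyTime fun a => Symb.bit (c a) :: f a := by
  convert hc.cond (hf.cons (.bit true)) (hf.cons (.bit false)) using 2 with a
  cases c a <;> rfl

theorem does_loop {step : β → Symb → β} {P : Symb → Prog} {T : Symb → β → ℕ} {B : ℕ}
    (h : ∀ a b, (P a).Does (enc b) (enc (step b a)) (T a b)) (l : List Symb) (b : β)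
    (hB : ∀ l', l' <+: l → ∀ a, T a (l'.foldl step b) ≤ B) :
    (Prog.loop 0 fun a => (P a).shift).Does (l :: enc b) ([] :: enc (l.foldl step b))
      (l.length * (B + 1) + 1) := by
  induction l generalizing b with
  | nil => exact ⟨1, by simp, fun ω τ => .loop_nil rfl⟩
  | cons a l ih =>
    obtain ⟨t₁, ht₁, h₁⟩ := h a b
    obtain ⟨t₂, ht₂, h₂⟩ := ih (step b a) fun l' hl' c =>
      hB (a :: l') ((List.prefix_cons_inj a).2 hl') c
    have := hB [] List.nil_prefix a
    refine ⟨1 + t₁ + t₂, ?_, fun ω τ => ?_⟩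
    · simp only [List.foldl_nil] at this
      simp only [List.length_cons]
      nlinarith
    · refine Prog.Run.loop_cons (a := a) (l := l) rfl ?_ ?_ (τ' := τ + 1 + t₁)
        (s' := Prog.scons l (Prog.st (enc (step b a))))
      · rw [Prog.st, Prog.update_scons_zero]
        exact (h₁ ω (τ + 1)).shift l
      · rw [show τ + (1 + t₁ + t₂) = τ + 1 + t₁ + t₂ by ring]
        exact h₂ ω _

/-- Bounded iteration: the letters of a word are processed one by one, and the size of the
intermediate results is bounded by a polynomial. -/
protected theorem foldl {l : α → List Symb} {b : α → β} {step : α → β → Symb → β} (hl : PolyTime l)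
    (hb : PolyTime b) (hstep : ∀ s, PolyTime fun p : α × β => step p.1 p.2 s) {B : α → ℕ}
    (hB : PolyBdd B) (h : ∀ a l', l' <+: l a → size (l'.foldl (step a) (b a)) ≤ B a) :
    PolyTime fun a => (l a).foldl (step a) (b a) := by
  have hstep' : ∀ s, PolyTime fun p : α × β => (p.1, step p.1 p.2 s) :=
    fun s => PolyTime.fst.pair (hstep s)
  choose P hP T hT hd using hstep'
  choose q hq using hT
  have hinit : PolyTime fun a => (l a, (a, b a)) := hl.pair (PolyTime.id.pair hb)
  obtain ⟨P₁, hP₁, T₁, hT₁, h₁⟩ := hinit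
  obtain ⟨P₃, hP₃, T₃, ⟨q₃, hq₃⟩, h₃⟩ :=
    PolyTime.snd.comp (PolyTime.snd (α := List Symb) (β := α × β))
  have key : ∀ a (l' : List Symb), l'.foldl (fun p s => (p.1, step p.1 p.2 s)) (a, b a) =
      (a, l'.foldl (step a) (b a)) := by
    intro a l'
    generalize b a = b'
    induction l' generalizing b' with
    | nil => rfl
    | cons c l' ih => exact ih _
  refine ⟨.seq P₁ (.seq (.loop 0 fun s => (P s).shift) P₃),
    ⟨hP₁, fun s => (hP s).shift, hP₃⟩,
    fun a => T₁ a + (((l a).length * ((∑ s, q s).eval (size a + B a) + 1) + 1) +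
      q₃.eval (size a + B a)), ?_, fun a => ?_⟩
  · refine hT₁.add ((PolyBdd.add (PolyBdd.mul ?_ (PolyBdd.add ?_ (.const 1))) (.const 1)).add ?_)
    · simpa using hl.size_bdd
    · exact (PolyBdd.size.add hB).eval _
    · exact (PolyBdd.size.add hB).eval _
  · refine (h₁ a).seq (Prog.Does.seq (l' := [] :: enc ((a, (l a).foldl (step a) (b a)) : α × β))
      ?_ ?_)
    · have := does_loop (B := (∑ s, q s).eval (size a + B a)) hd (l a) (a, b a) ?_
      · rw [key] at this
        exact this
      · intro l' hl' s
        rw [key]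
        refine (hq s _).trans ?_
        rw [Polynomial.eval_finsetSum]
        refine le_trans ?_ (Finset.single_le_sum (f := fun s => (q s).eval (size a + B a))
          (fun _ _ => Nat.zero_le _) (Finset.mem_univ s))
        exact (q s).eval_nat_mono (by simpa using h a l' hl')
    · refine (h₃ ([], (a, (l a).foldl (step a) (b a)))).mono ((hq₃ _).trans ?_)
      exact q₃.eval_nat_mono (by simpa using h a (l a) (List.prefix_refl _))

end PolyTime

/-! ### Polynomial-time programs and polynomial-time Turing machines -/

theorem inputStore_two (input : Fin 2 → List Symb) :
    Prog.inputStore input = Prog.st (enc (input 0, input 1)) := by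
  funext i
  match i with
  | 0 => rfl
  | 1 => rfl
  | i + 2 => simp [Prog.inputStore, enc]

theorem inputStore_one (input : Fin 1 → List Symb) :
    Prog.inputStore input = Prog.st (enc (input 0)) := by
  funext i
  match i with
  | 0 => rfl
  | i + 1 => simp [Prog.inputStore, enc]

/-- A set of pairs of words with a characteristic function that is computed in polynomial time by a
stack program is decided by a deterministic polynomial-time Turing machine. -/
theorem PolyTime.deterministicPolyTime {D : List Symb × List Symb → Bool} (hD : PolyTime D)
    {S : Set (Fin 2 → List Symb)} (hS : ∀ input, input ∈ S ↔ D (input 0, input 1) = true) :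
    DeterministicPolyTime S := by
  obtain ⟨P, hP, T, ⟨q, hq⟩, h⟩ := hD
  obtain ⟨k, hk⟩ := P.exists_bdd
  refine ⟨max k 1, P.ntm _, hP.isDeterministic _, q + 1, fun input => ?_⟩
  obtain ⟨t, ht, H⟩ := h (input 0, input 1)
  have := Prog.ntm_spec (hk.mono (le_max_left k 1)) (lt_max_of_lt_right Nat.one_pos) input
    (fun ω => by rw [inputStore_two, ← zero_add t]; exact H ω 0)
    (fun _ => ht.trans (hq (input 0, input 1)))
  rw [hS]
  convert this using 2
  · simp
  · simp [enc]

/-- The letters guessed in `n` rounds of a loop that starts at time `τ`, in front of `g`. -/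
def guesses (ω : ℕ → Option Symb) : ℕ → ℕ → List Symb → List Symb
  | 0, _, g => g
  | n + 1, τ, g => guesses ω n (τ + 3) ((ω (τ + 2)).toList ++ g)

theorem length_guesses_le (ω : ℕ → Option Symb) (n τ : ℕ) (g : List Symb) :
    (guesses ω n τ g).length ≤ n + g.length := by
  induction n generalizing τ g with
  | zero => simp [guesses]
  | succ n ih =>
    refine (ih _ _).trans ?_
    cases ω (τ + 2) <;> (simp; try omega)

theorem exists_guesses_eq (τ : ℕ) {n : ℕ} {c : List Symb} (hc : c.length ≤ n) :
    ∃ ω, guesses ω n τ [] = c := by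
  refine ⟨fun t => c.reverse[(t - τ) / 3]?, ?_⟩
  have key : ∀ n i g, guesses (fun t => c.reverse[(t - τ) / 3]?) n (τ + 3 * i) g =
      ((c.reverse.drop i).take n).reverse ++ g := by
    intro n
    induction n with
    | zero => simp [guesses]
    | succ n ih =>
      intro i g
      have e : (τ + 3 * i + 2 - τ) / 3 = i := by omega
      rw [guesses, show τ + 3 * i + 3 = τ + 3 * (i + 1) by ring, ih, e]
      by_cases hi : i < c.reverse.length
      · rw [List.getElem?_eq_getElem hi, List.drop_eq_getElem_cons hi]
        simp
      · rw [List.getElem?_eq_none (by omega), List.drop_eq_nil_of_le (by omega),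
          List.drop_eq_nil_of_le (by omega)]
        simp
  have := key n 0 []
  rw [Nat.mul_zero, add_zero] at this
  rw [this, List.drop_zero, List.take_of_length_le (by simpa using hc)]
  simp

/-- Guess a word on stack `1` that is at most as long as stack `2`, which is emptied. -/
def Prog.guessLoop : Prog := .loop 2 fun _ => .guess 1

theorem Prog.run_guessLoop (ω τ) (w g l : List Symb) :
    Run ω guessLoop τ (st [w, g, l]) (τ + 3 * l.length + 1)
      (st [w, guesses ω l.length τ g]) := by
  induction l generalizing τ g with
  | nil =>
    change Run ω guessLoop τ (st [w, g, []]) (τ + 1) (st [w, g])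
    rw [← st_append_nil [w, g]]
    exact .loop_nil rfl
  | cons a l ih =>
    have h := Run.guess (ω := ω) 1 (τ + 1) (st [w, g, l])
    have e : ∀ x, Function.update (st [w, g, l]) 1 x = st [w, x, l] := fun x => by
      simp only [st, update_scons_succ, update_scons_zero]
    have e' : Function.update (st [w, g, a :: l]) 2 l = st [w, g, l] := by
      simp only [st, update_scons_succ, update_scons_zero]
    rw [e] at h
    refine .loop_cons (a := a) (l := l) rfl ?_ ?_ (τ' := τ + 3)
      (s' := st [w, (ω (τ + 2)).toList ++ g, l])
    · rw [e']
      exact h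
    · convert ih (τ + 3) ((ω (τ + 2)).toList ++ g) using 1
      · rfl
      · simp only [List.length_cons]; ring
      · rfl

/-- A set of words is decided by a nondeterministic polynomial-time Turing machine if membership
means the existence of a certificate of bounded length that can be verified in polynomial time. -/
theorem PolyTime.nondeterministicPolyTime {clock : List Symb → List Symb} (hclock : PolyTime clock)
    {D : List Symb × List Symb → Bool} (hD : PolyTime D) {S : Set (Fin 1 → List Symb)}
    (hS : ∀ input, input ∈ S ↔
      ∃ c, c.length ≤ (clock (input 0)).length ∧ D (input 0, c) = true) :
    NondeterministicPolyTime S := by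
  have hc := hclock.size_bdd
  obtain ⟨P, -, T, hT, h⟩ := PolyTime.id.pair (PolyTime.nil.pair hclock)
  obtain ⟨P', -, T', ⟨q', hq'⟩, h'⟩ := hD
  obtain ⟨q, hq⟩ : PolyBdd fun w : List Symb =>
      T w + (3 * size (clock w) + 1) + q'.eval (size w + size (clock w)) :=
    (hT.add (((PolyBdd.const 3).mul hc).add (.const 1))).add ((PolyBdd.size.add hc).eval q')
  obtain ⟨k, hk⟩ := (Prog.seq P (.seq .guessLoop P')).exists_bdd
  refine ⟨max k 1, Prog.ntm (.seq P (.seq .guessLoop P')) _, q + 1, fun input => ?_⟩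
  obtain ⟨t, ht, H⟩ := h (input 0)
  choose t' ht' H' using h'
  have hlen : ∀ ω, (guesses ω (clock (input 0)).length t []).length ≤
      (clock (input 0)).length := fun ω => by
    simpa using length_guesses_le ω (clock (input 0)).length t []
  have hrun : ∀ ω, Prog.Run ω (.seq P (.seq .guessLoop P')) 0 (Prog.inputStore input)
      (t + 3 * (clock (input 0)).length + 1 +
        t' (input 0, guesses ω (clock (input 0)).length t []))
      (Prog.st (enc (D (input 0, guesses ω (clock (input 0)).length t [])))) := fun ω => by
    rw [inputStore_one]
    have := H ω 0
    rw [zero_add] at this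
    exact this.seq ((Prog.run_guessLoop ω t _ _ _).seq
      (H' (input 0, guesses ω (clock (input 0)).length t []) ω _))
  have := Prog.ntm_spec (hk.mono (le_max_left k 1)) (lt_max_of_lt_right Nat.one_pos) input hrun
    (T := q.eval (input 0).length) (fun ω => by
      have h₁ := hq (input 0)
      have h₂ := (ht' (input 0, guesses ω (clock (input 0)).length t [])).trans (hq' _)
      have h₃ : q'.eval (size (input 0, guesses ω (clock (input 0)).length t [])) ≤
          q'.eval (size (input 0) + size (clock (input 0))) :=
        q'.eval_nat_mono (by simpa using hlen ω)
      simp only [size_word] at h₁ h₃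
      omega)
  rw [hS]
  convert this using 2
  · simp
  · constructor
    · rintro ⟨c, hc, hD⟩
      obtain ⟨ω, hω⟩ := exists_guesses_eq t hc
      exact ⟨ω, by simp [hω, hD, enc]⟩
    · rintro ⟨ω, hω⟩
      exact ⟨_, hlen ω, by simpa [enc] using hω⟩

/-! ### Arithmetic of binary numerals in polynomial time -/

/-- Does a numeral with this first letter have the last binary digit `1`? -/
def isOne (o : Option Symb) : Bool := decide (o = some (.bit true))

/-- The value of a word as a binary numeral, least significant digit first. All letters other than
the digit `1` count as the digit `0`. -/
def numVal : List Symb → ℕ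
  | [] => 0
  | a :: l => (isOne (some a)).toNat + 2 * numVal l

theorem numVal_eq (l : List Symb) : numVal l = (isOne l.head?).toNat + 2 * numVal l.tail := by
  cases l <;> rfl

theorem numVal_append (l m : List Symb) :
    numVal (l ++ m) = numVal l + 2 ^ l.length * numVal m := by
  induction l with
  | nil => simp [numVal]
  | cons a l ih => simp only [List.cons_append, numVal, ih, List.length_cons, pow_succ]; ring

theorem numVal_map_bit (l : List Bool) : numVal (l.map Symb.bit) = bitsValue l := by
  induction l with
  | nil => rfl
  | cons b l ih =>
    simp only [List.map_cons, numVal, ih, bitsValue, Nat.ofDigits_cons, isOne]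
    cases b <;> simp

namespace PolyTime

variable {α β γ δ : Type} [Coded α] [Coded β] [Coded γ] [Coded δ]

protected theorem reverse {f : α → List Symb} (hf : PolyTime f) :
    PolyTime fun a => (f a).reverse := by
  have := PolyTime.foldl (l := f) (b := fun _ => []) (step := fun _ r s => s :: r) hf .nil
    (fun s => PolyTime.snd.cons s) hf.size_bdd (fun a l' h => by simpa using h.length_le)
  simpa using this

protected theorem append {f g : α → List Symb} (hf : PolyTime f) (hg : PolyTime g) :
    PolyTime fun a => f a ++ g a := by
  have := PolyTime.foldl (l := fun a => (f a).reverse) (b := g) (step := fun _ r s => s :: r)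
    hf.reverse hg
    (fun s => PolyTime.snd.cons s) (hf.size_bdd.add hg.size_bdd) (fun a l' h => by
      simpa using h.length_le)
  simpa using this

end PolyTime

/-- One step of the addition of two numerals: the state consists of the remaining digits of the
summands, the carry, and the digits of the sum found so far in reverse order. -/
def addStep (p : (List Symb × List Symb) × (Bool × List Symb)) :
    (List Symb × List Symb) × (Bool × List Symb) :=
  ((p.1.1.tail, p.1.2.tail),
    ((isOne p.1.1.head? && isOne p.1.2.head?) ||
        (p.2.1 && (isOne p.1.1.head? || isOne p.1.2.head?)),
      .bit (Bool.xor (Bool.xor (isOne p.1.1.head?) (isOne p.1.2.head?)) p.2.1) :: p.2.2))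

/-- The state of the addition after some steps. The letters of the third argument only count the
steps. -/
def addSteps (l m t : List Symb) : (List Symb × List Symb) × (Bool × List Symb) :=
  t.foldl (fun p _ => addStep p) ((l, m), (false, []))

/-- A numeral for the sum of two numerals. -/
def numAdd (l m : List Symb) : List Symb :=
  (.bit (addSteps l m (l ++ m)).2.1 :: (addSteps l m (l ++ m)).2.2).reverse

theorem addSteps_append_singleton (l m t : List Symb) (s : Symb) :
    addSteps l m (t ++ [s]) = addStep (addSteps l m t) := by
  simp [addSteps]

theorem addSteps_spec (l m t : List Symb) :
    (addSteps l m t).1 = (l.drop t.length, m.drop t.length) ∧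
    (addSteps l m t).2.2.length = t.length ∧
    numVal (addSteps l m t).2.2.reverse + 2 ^ t.length * ((addSteps l m t).2.1.toNat +
      numVal (l.drop t.length) + numVal (m.drop t.length)) = numVal l + numVal m := by
  induction t using List.reverseRecOn with
  | nil => simp [addSteps, numVal]
  | append_singleton t s ih =>
    obtain ⟨h₁, h₂, h₃⟩ := ih
    rw [addSteps_append_singleton]
    generalize addSteps l m t = p at *
    obtain ⟨⟨l', m'⟩, c, r⟩ := p
    simp only [Prod.mk.injEq] at h₁ h₂ h₃
    obtain ⟨h₁, h₁'⟩ := h₁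
    have e : ∀ l : List Symb, l.drop (t ++ [s]).length = (l.drop t.length).tail := fun l => by
      simp
    rw [e, e, ← h₁, ← h₁']
    refine ⟨rfl, by simp [addStep, h₂], ?_⟩
    rw [← h₃, ← h₁, ← h₁', numVal_eq l', numVal_eq m']
    simp only [addStep, List.reverse_cons, numVal_append, List.length_reverse, h₂,
      List.length_append, List.length_singleton, pow_succ, numVal]
    have hb : ∀ x y : Bool, isOne (some (.bit (Bool.xor x y))) = Bool.xor x y := by decide
    rw [hb]
    cases isOne l'.head? <;> cases isOne m'.head? <;> cases c <;> simp <;> ring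

theorem numVal_numAdd (l m : List Symb) : numVal (numAdd l m) = numVal l + numVal m := by
  obtain ⟨-, h₂, h₃⟩ := addSteps_spec l m (l ++ m)
  rw [← h₃, numAdd, List.reverse_cons, numVal_append, List.length_reverse, h₂,
    List.drop_eq_nil_of_le (by simp), List.drop_eq_nil_of_le (by simp)]
  cases (addSteps l m (l ++ m)).2.1 <;> simp [numVal, isOne]

theorem length_numAdd (l m : List Symb) : (numAdd l m).length = l.length + m.length + 1 := by
  obtain ⟨-, h₂, -⟩ := addSteps_spec l m (l ++ m)
  simp [numAdd, h₂]

/-- A numeral for the product of two numerals: the state of the iteration consists of the second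
factor, shifted by the number of steps, and of the sum found so far. -/
def numMul (l m : List Symb) : List Symb :=
  (l.foldl (fun p s => (.bit false :: p.1, bif isOne (some s) then numAdd p.2 p.1 else p.2))
    (m, [])).2

theorem numMul_aux (l m r : List Symb) :
    numVal (l.foldl (fun p s =>
      (.bit false :: p.1, bif isOne (some s) then numAdd p.2 p.1 else p.2)) (m, r)).2 =
      numVal r + numVal l * numVal m := by
  induction l generalizing m r with
  | nil => simp [numVal]
  | cons a l ih =>
    rw [List.foldl_cons, ih]
    have h₀ : isOne (some (.bit false)) = false := by decide
    cases h : isOne (some a)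
    · simp [numVal, h, h₀]; ring
    · simp [numVal, h, h₀, numVal_numAdd]; ring

theorem numVal_numMul (l m : List Symb) : numVal (numMul l m) = numVal l * numVal m := by
  rw [numMul, numMul_aux]
  simp [numVal]

theorem length_numMul_aux (l m : List Symb) :
    (l.foldl (fun p s => (Symb.bit false :: p.1,
      bif isOne (some s) then numAdd p.2 p.1 else p.2)) (m, [])).1.length = m.length + l.length ∧
    (l.foldl (fun p s => (Symb.bit false :: p.1,
      bif isOne (some s) then numAdd p.2 p.1 else p.2)) (m, [])).2.length ≤
        l.length * (m.length + l.length) := by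
  induction l using List.reverseRecOn with
  | nil => simp
  | append_singleton l a ih =>
    rw [List.foldl_append]
    simp only [List.foldl_cons, List.foldl_nil]
    generalize l.foldl _ _ = p at *
    obtain ⟨h₁, h₂⟩ := ih
    refine ⟨by simp [h₁]; omega, ?_⟩
    cases isOne (some a)
    · simp only [cond_false, List.length_append, List.length_singleton]
      nlinarith
    · simp only [cond_true, length_numAdd, h₁, List.length_append, List.length_singleton]
      nlinarith

/-- Do two numerals have the same value? The state of the iteration consists of the remaining
digits and of the outcome of the comparison of the other digits. -/
def numEq (l m : List Symb) : Bool :=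
  ((l ++ m).foldl (fun p _ => ((p.1.1.tail, p.1.2.tail),
    p.2 && !(Bool.xor (isOne p.1.1.head?) (isOne p.1.2.head?)))) ((l, m), true)).2

theorem numEq_aux (t l m : List Symb) (b : Bool) (hl : l.length ≤ t.length)
    (hm : m.length ≤ t.length) :
    (t.foldl (fun p _ => ((p.1.1.tail, p.1.2.tail),
      p.2 && !(Bool.xor (isOne p.1.1.head?) (isOne p.1.2.head?)))) ((l, m), b)).2 =
      (b && decide (numVal l = numVal m)) := by
  induction t generalizing l m b with
  | nil =>
    obtain rfl := List.length_eq_zero_iff.1 (Nat.le_zero.1 hl)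
    obtain rfl := List.length_eq_zero_iff.1 (Nat.le_zero.1 hm)
    simp
  | cons a t ih =>
    rw [List.foldl_cons, ih _ _ _ (by simp at hl ⊢; omega) (by simp at hm ⊢; omega)]
    rw [numVal_eq l, numVal_eq m]
    have h₀ : ∀ x y : ℕ, ¬ (2 * x = 1 + 2 * y) := by omega
    have h₁ : ∀ x y : ℕ, ¬ (1 + 2 * x = 2 * y) := by omega
    cases isOne l.head? <;> cases isOne m.head? <;> simp [h₀, h₁]

theorem numEq_eq (l m : List Symb) : numEq l m = decide (numVal l = numVal m) := by
  rw [numEq, numEq_aux _ _ _ _ (by simp) (by simp), Bool.true_and]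

namespace PolyTime

variable {α β γ δ : Type} [Coded α] [Coded β] [Coded γ] [Coded δ]

theorem numAdd {f g : α → List Symb} (hf : PolyTime f) (hg : PolyTime g) :
    PolyTime fun a => numAdd (f a) (g a) := by
  have h₁ : PolyTime fun p : (List Symb × List Symb) × (Bool × List Symb) => p.1.1 :=
    PolyTime.fst.comp .fst
  have h₂ : PolyTime fun p : (List Symb × List Symb) × (Bool × List Symb) => p.1.2 :=
    PolyTime.snd.comp .fst
  have h₃ : PolyTime fun p : (List Symb × List Symb) × (Bool × List Symb) => p.2.1 :=
    PolyTime.fst.comp .snd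
  have h₄ : PolyTime fun p : (List Symb × List Symb) × (Bool × List Symb) => p.2.2 :=
    PolyTime.snd.comp .snd
  have i₁ := h₁.head_test isOne
  have i₂ := h₂.head_test isOne
  have hstep : PolyTime addStep := (h₁.tail.pair h₂.tail).pair
    (((i₁.and i₂).or (h₃.and (i₁.or i₂))).pair (((i₁.xor i₂).xor h₃).cons_bit h₄))
  have hs : PolyTime fun a => addSteps (f a) (g a) (f a ++ g a) := by
    refine PolyTime.foldl (l := fun a => f a ++ g a) (b := fun a => ((f a, g a), (false, [])))
      (step := fun _ p _ => addStep p) (hf.append hg)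
      ((hf.pair hg).pair ((const_bool false).pair .nil)) (fun s => hstep.comp .snd)
      (B := fun a => size (f a) + size (g a) + 1 + (size (f a) + size (g a)))
      (((hf.size_bdd.add hg.size_bdd).add (.const 1)).add (hf.size_bdd.add hg.size_bdd))
      fun a l' h => ?_
    obtain ⟨e₁, e₂, -⟩ := addSteps_spec (f a) (g a) l'
    have := h.length_le
    change size (addSteps (f a) (g a) l') ≤ _
    simp only [size_prod, e₁, e₂, size_word, List.length_drop, size_bool, List.length_append]
      at this ⊢
    omega
  exact ((PolyTime.fst.comp (PolyTime.snd.comp hs)).cons_bit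
    (PolyTime.snd.comp (PolyTime.snd.comp hs))).reverse

theorem numMul {f g : α → List Symb} (hf : PolyTime f) (hg : PolyTime g) :
    PolyTime fun a => numMul (f a) (g a) := by
  refine PolyTime.snd.comp (PolyTime.foldl (l := f) (b := fun a => (g a, [])) (step := fun _ p s =>
    (.bit false :: p.1, bif isOne (some s) then _root_.numAdd p.2 p.1 else p.2)) hf (hg.pair .nil)
    (fun s => ?_) (B := fun a => size (g a) + size (f a) + size (f a) * (size (g a) + size (f a)))
    ((hg.size_bdd.add hf.size_bdd).add (hf.size_bdd.mul (hg.size_bdd.add hf.size_bdd)))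
    fun a l' h => ?_)
  · have h₁ : PolyTime fun p : α × (List Symb × List Symb) => p.2.1 := PolyTime.fst.comp .snd
    have h₂ : PolyTime fun p : α × (List Symb × List Symb) => p.2.2 := PolyTime.snd.comp .snd
    exact (h₁.cons (.bit false)).pair ((const_bool (isOne (some s))).cond (h₂.numAdd h₁) h₂)
  · obtain ⟨h₁, h₂⟩ := length_numMul_aux l' (g a)
    have := h.length_le
    rw [size_prod]
    simp only [size_word]
    rw [h₁]
    have : l'.length * ((g a).length + l'.length) ≤
      (f a).length * ((g a).length + (f a).length) := by gcongr
    omega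

theorem numEq {f g : α → List Symb} (hf : PolyTime f) (hg : PolyTime g) :
    PolyTime fun a => numEq (f a) (g a) := by
  refine PolyTime.snd.comp (PolyTime.foldl (l := fun a => f a ++ g a)
    (b := fun a => ((f a, g a), true))
    (step := fun _ p _ => ((p.1.1.tail, p.1.2.tail),
      p.2 && !(Bool.xor (isOne p.1.1.head?) (isOne p.1.2.head?)))) (hf.append hg)
    ((hf.pair hg).pair (const_bool true)) (fun s => ?_)
    (B := fun a => size (f a) + size (g a) + 1) ((hf.size_bdd.add hg.size_bdd).add (.const 1))
    fun a l' h => ?_)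
  · have h₁ : PolyTime fun p : α × ((List Symb × List Symb) × Bool) => p.2.1.1 :=
      PolyTime.fst.comp (PolyTime.fst.comp .snd)
    have h₂ : PolyTime fun p : α × ((List Symb × List Symb) × Bool) => p.2.1.2 :=
      PolyTime.snd.comp (PolyTime.fst.comp .snd)
    exact (h₁.tail.pair h₂.tail).pair ((PolyTime.snd.comp .snd).and
      ((h₁.head_test isOne).xor (h₂.head_test isOne)).not)
  · clear h
    generalize true = b, f a = x, g a = y
    induction l' generalizing x y b with
    | nil => simp
    | cons s l' ih =>
      refine (ih _ _ _).trans ?_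
      simp
      omega

end PolyTime

/-! ### The verification algorithm -/

/-- The part of a word before the first occurrence of a letter. -/
def before (s : Symb) (l : List Symb) : List Symb := l.takeWhile fun a => decide (a ≠ s)

/-- The part of a word after the first occurrence of a letter. -/
def after (s : Symb) (l : List Symb) : List Symb := (l.dropWhile fun a => decide (a ≠ s)).tail

/-- Is the letter a binary digit? -/
def isBit : Symb → Bool
  | .bit _ => true
  | _ => false

/-- Is the word a fraction of two binary numerals with a nonzero denominator? -/
def isFrac (e : List Symb) : Bool :=
  (!(e.all fun a => decide (a ≠ .slash)) && (before .slash e).all isBit) &&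
    ((after .slash e).all isBit && !numEq (after .slash e) [])

/-- Does the word start with a minus sign? -/
def isNeg (e : List Symb) : Bool := decide (e.head? = some .minus)

/-- Remove the minus sign. -/
def unsign (e : List Symb) : List Symb := bif isNeg e then e.tail else e

/-- The test whether the absolute value of the difference of the fractions `u` and `v` with signs is
the fraction `e`. With `u = ±a/b`, `v = ±c/d` and `e = p/q`, it compares the products `adq`, `cbq`
and `pbd`. -/
def distOK (e u v : List Symb) : Bool :=
  let A := numMul (numMul (before .slash (unsign u)) (after .slash (unsign v))) (after .slash e)
  let B := numMul (numMul (before .slash (unsign v)) (after .slash (unsign u))) (after .slash e)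
  let C := numMul (numMul (before .slash e) (after .slash (unsign u))) (after .slash (unsign v))
  bif Bool.xor (isNeg u) (isNeg v) then numEq (numAdd A B) C
    else numEq A (numAdd B C) || numEq B (numAdd A C)

/-- The test of an entry `e` of the weighted adjacency matrix against the coordinates `u` and `v` of
the two vertices. -/
def entryOK (e u v : List Symb) : Bool :=
  decide (e = [.noEdge]) || (isFrac e && distOK e u v)

/-- The state of the test of a rational vector: the outcome so far, and the letters since the last
comma in reverse order. -/
def vecStep (p : Bool × List Symb) (s : Symb) : Bool × List Symb :=
  bif decide (s = .comma) then (p.1 && isFrac (unsign p.2.reverse), []) else (p.1, s :: p.2)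

/-- The test whether a word encodes a rational vector. -/
def vecOK (c : List Symb) : Bool :=
  (c.foldl vecStep (true, [])).1 && decide ((c.foldl vecStep (true, [])).2 = [])

/-- The state of the test of an instance against the vector `c`: the outcome so far, the letters
since the last end of an entry or of a row in reverse order, and the parts of `c` that start with
the coordinates that belong to the current row and to the current column. -/
def wordStep (c : List Symb) (p : (Bool × List Symb) × (List Symb × List Symb)) (s : Symb) :
    (Bool × List Symb) × (List Symb × List Symb) :=
  bif decide (s = .comma) then
    ((p.1.1 && ((!decide (p.2.1 = []) && !decide (p.2.1 = p.2.2)) &&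
        entryOK p.1.2.reverse (before .comma p.2.1) (before .comma p.2.2)), []),
      (p.2.1, after .comma p.2.2))
  else bif decide (s = .endRow) then
    ((p.1.1 && (decide (p.1.2 = []) && (!decide (p.2.1 = []) && decide (p.2.1 = p.2.2))), []),
      (after .comma p.2.1, c))
  else ((p.1.1, s :: p.1.2), p.2)

/-- The outcome of the test of an instance against a vector. -/
def wordAccepts (p : (Bool × List Symb) × (List Symb × List Symb)) : Bool :=
  p.1.1 && (decide (p.1.2 = []) && decide (p.2.1 = []))

/-- The test whether the second word encodes a rational realization of the instance encoded by the
first word. -/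
def verify (p : List Symb × List Symb) : Bool :=
  vecOK p.2 && wordAccepts (p.1.foldl (wordStep p.2) ((true, []), (p.2, p.2)))

namespace PolyTime

variable {α : Type} [Coded α] {f g h : α → List Symb}

theorem eq_nil (hf : PolyTime f) : PolyTime fun a => decide (f a = []) := by
  convert hf.head_test (fun o => o.isNone) using 2 with a
  cases f a <;> rfl

theorem all (hf : PolyTime f) (p : Symb → Bool) : PolyTime fun a => (f a).all p := by
  have := PolyTime.foldl (l := f) (b := fun _ => true) (step := fun _ b s => b && p s) hf
    (const_bool true) (fun s => PolyTime.snd.and (const_bool (p s))) (.const 1)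
    (fun a l' _ => by simp)
  have key : ∀ (l : List Symb) b, l.foldl (fun b s => b && p s) b = (b && l.all p) := by
    intro l
    induction l with
    | nil => simp
    | cons s l ih =>
      intro b
      rw [List.foldl_cons, ih, List.all_cons, Bool.and_assoc]
  simpa only [key, Bool.true_and] using this

theorem takeWhile (hf : PolyTime f) (p : Symb → Bool) : PolyTime fun a => (f a).takeWhile p := by
  have key : ∀ (l : List Symb) b r, (l.foldl (fun (q : Bool × List Symb) s =>
      bif q.1 && p s then (true, s :: q.2) else (false, q.2)) (b, r)).2 =
        (bif b then l.takeWhile p else []).reverse ++ r := by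
    intro l
    induction l with
    | nil => intro b r; cases b <;> rfl
    | cons s l ih =>
      intro b r
      rw [List.foldl_cons, List.takeWhile_cons]
      cases b <;> cases p s <;> simp [ih]
  have hlen : ∀ l : List Symb, (l.takeWhile p).length ≤ l.length := fun l =>
    (List.takeWhile_prefix p).length_le
  have := PolyTime.foldl (l := f) (b := fun _ => (true, []))
    (step := fun _ q s => bif q.1 && p s then (true, s :: q.2) else (false, q.2)) hf
    ((const_bool true).pair .nil)
    (fun s => (((PolyTime.fst.comp .snd).and (const_bool (p s))).cond
      ((const_bool true).pair ((PolyTime.snd.comp .snd).cons s))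
      ((const_bool false).pair (PolyTime.snd.comp .snd))))
    ((PolyBdd.const 1).add hf.size_bdd) (fun a l' hl => by
      have h₁ := hl.length_le
      have h₂ := hlen l'
      simp only [size_prod, key, size_bool, size_word]
      simp
      omega)
  convert (PolyTime.snd.comp this).reverse using 2 with a
  rw [key]
  simp

theorem dropWhile (hf : PolyTime f) (p : Symb → Bool) : PolyTime fun a => (f a).dropWhile p := by
  have key : ∀ (l : List Symb) b r, (l.foldl (fun (q : Bool × List Symb) s =>
      bif q.1 && p s then (true, q.2) else (false, s :: q.2)) (b, r)).2 =
        (bif b then l.dropWhile p else l).reverse ++ r := by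
    intro l
    induction l with
    | nil => intro b r; cases b <;> rfl
    | cons s l ih =>
      intro b r
      rw [List.foldl_cons, List.dropWhile_cons]
      cases b <;> cases p s <;> simp [ih]
  have hlen : ∀ l : List Symb, (l.dropWhile p).length ≤ l.length := fun l =>
    (List.dropWhile_suffix p).length_le
  have := PolyTime.foldl (l := f) (b := fun _ => (true, []))
    (step := fun _ q s => bif q.1 && p s then (true, q.2) else (false, s :: q.2)) hf
    ((const_bool true).pair .nil)
    (fun s => (((PolyTime.fst.comp .snd).and (const_bool (p s))).cond
      ((const_bool true).pair (PolyTime.snd.comp .snd))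
      ((const_bool false).pair ((PolyTime.snd.comp .snd).cons s))))
    ((PolyBdd.const 1).add hf.size_bdd) (fun a l' hl => by
      have h₁ := hl.length_le
      have h₂ := hlen l'
      simp only [size_prod, key, size_bool, size_word]
      simp
      omega)
  convert (PolyTime.snd.comp this).reverse using 2 with a
  rw [key]
  simp

theorem before (hf : PolyTime f) (s : Symb) : PolyTime fun a => before s (f a) := hf.takeWhile _

theorem after (hf : PolyTime f) (s : Symb) : PolyTime fun a => after s (f a) :=
  (hf.dropWhile _).tail

theorem eq_word (hf : PolyTime f) (hg : PolyTime g) : PolyTime fun a => decide (f a = g a) := by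
  have key : ∀ (l m : List Symb) b, (l.foldl (fun (q : List Symb × Bool) s =>
      (q.1.tail, q.2 && decide (q.1.head? = some s))) (m, b)).1 = m.drop l.length ∧
      ((l.foldl (fun (q : List Symb × Bool) s =>
        (q.1.tail, q.2 && decide (q.1.head? = some s))) (m, b)).2 = true ↔
          b = true ∧ l <+: m) := by
    intro l
    induction l with
    | nil => intro m b; simp
    | cons s l ih =>
      intro m b
      obtain ⟨h₁, h₂⟩ := ih m.tail (b && decide (m.head? = some s))
      rw [List.foldl_cons]
      refine ⟨by rw [h₁]; simp, h₂.trans ?_⟩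
      cases m with
      | nil => simp
      | cons s' m =>
        simp only [List.head?_cons, List.tail_cons, Bool.and_eq_true, decide_eq_true_iff,
          Option.some.injEq, List.cons_prefix_cons, and_assoc, @eq_comm _ s' s]
  have := PolyTime.foldl (l := f) (b := fun a => (g a, true))
    (step := fun _ q s => (q.1.tail, q.2 && decide (q.1.head? = some s))) hf
    (hg.pair (const_bool true))
    (fun s => (PolyTime.fst.comp .snd).tail.pair ((PolyTime.snd.comp .snd).and
      ((PolyTime.fst.comp .snd).head_test fun o => decide (o = some s))))
    (hg.size_bdd.add (.const 1)) (fun a l' hl => by simp [key])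
  convert (PolyTime.snd.comp this).and (PolyTime.fst.comp this).eq_nil using 2 with a
  obtain ⟨h₁, h₂⟩ := key (f a) (g a) true
  rw [Bool.eq_iff_iff, Bool.and_eq_true, decide_eq_true_iff, decide_eq_true_iff, h₁, h₂]
  constructor
  · intro h
    simp [h]
  · rintro ⟨⟨-, t, ht⟩, h⟩
    rw [← ht, List.drop_left] at h
    rw [← ht, h, List.append_nil]

theorem isFrac (hf : PolyTime f) : PolyTime fun a => isFrac (f a) :=
  ((hf.all _).not.and ((hf.before _).all _)).and
    (((hf.after _).all _).and ((hf.after _).numEq .nil).not)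

theorem isNeg (hf : PolyTime f) : PolyTime fun a => isNeg (f a) :=
  hf.head_test fun o => decide (o = some .minus)

theorem unsign (hf : PolyTime f) : PolyTime fun a => unsign (f a) := hf.isNeg.cond hf.tail hf

theorem distOK (hf : PolyTime f) (hg : PolyTime g) (hh : PolyTime h) :
    PolyTime fun a => distOK (f a) (g a) (h a) := by
  have hA := ((hg.unsign.before .slash).numMul (hh.unsign.after .slash)).numMul (hf.after .slash)
  have hB := ((hh.unsign.before .slash).numMul (hg.unsign.after .slash)).numMul (hf.after .slash)
  have hC := ((hf.before .slash).numMul (hg.unsign.after .slash)).numMul (hh.unsign.after .slash)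
  exact (hg.isNeg.xor hh.isNeg).cond ((hA.numAdd hB).numEq hC)
    ((hA.numEq (hB.numAdd hC)).or (hB.numEq (hA.numAdd hC)))

theorem entryOK (hf : PolyTime f) (hg : PolyTime g) (hh : PolyTime h) :
    PolyTime fun a => entryOK (f a) (g a) (h a) :=
  (hf.eq_word (PolyTime.nil.cons .noEdge)).or (hf.isFrac.and (hf.distOK hg hh))

theorem vecOK (hf : PolyTime f) : PolyTime fun a => vecOK (f a) := by
  have h₁ : PolyTime fun p : α × (Bool × List Symb) => p.2.1 := PolyTime.fst.comp .snd
  have h₂ : PolyTime fun p : α × (Bool × List Symb) => p.2.2 := PolyTime.snd.comp .snd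
  have key : ∀ l : List Symb, (l.foldl vecStep (true, [])).2.length ≤ l.length := by
    intro l
    induction l using List.reverseRecOn with
    | nil => simp
    | append_singleton l s ih =>
      rw [List.foldl_append, List.foldl_cons, List.foldl_nil, vecStep]
      cases decide (s = .comma) <;> simp [ih]
  have := PolyTime.foldl (l := f) (b := fun _ => (true, [])) (step := fun _ => vecStep) hf
    ((const_bool true).pair .nil)
    (fun s => (const_bool _).cond ((h₁.and h₂.reverse.unsign.isFrac).pair .nil)
      (h₁.pair (h₂.cons s)))
    ((PolyBdd.const 1).add hf.size_bdd) (fun a l' hl => by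
      have h₁ := hl.length_le
      have h₂ := key l'
      simp only [size_prod, size_bool, size_word]
      omega)
  exact (PolyTime.fst.comp this).and (PolyTime.snd.comp this).eq_nil

end PolyTime

theorem length_wordStep_le (c l : List Symb) :
    (l.foldl (wordStep c) ((true, []), (c, c))).1.2.length ≤ l.length ∧
    (l.foldl (wordStep c) ((true, []), (c, c))).2.1.length ≤ c.length ∧
    (l.foldl (wordStep c) ((true, []), (c, c))).2.2.length ≤ c.length := by
  have hafter : ∀ m, (after .comma m).length ≤ m.length := fun m => by
    have := (List.dropWhile_suffix (fun a => decide (a ≠ Symb.comma)) (l := m)).length_le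
    simp only [after, List.length_tail]
    omega
  induction l using List.reverseRecOn with
  | nil => simp
  | append_singleton l s ih =>
    obtain ⟨h₁, h₂, h₃⟩ := ih
    rw [List.foldl_append, List.foldl_cons, List.foldl_nil, wordStep]
    cases decide (s = .comma)
    · cases decide (s = .endRow)
      · simp [h₁, h₂, h₃]
      · simp [(hafter _).trans h₂]
    · simp [h₂, (hafter _).trans h₃]

theorem polyTime_verify : PolyTime verify := by
  have g₁ : PolyTime fun p : (List Symb × List Symb) × ((Bool × List Symb) ×
    (List Symb × List Symb)) => p.2.1.1 := PolyTime.fst.comp (PolyTime.fst.comp .snd)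
  have g₂ : PolyTime fun p : (List Symb × List Symb) × ((Bool × List Symb) ×
    (List Symb × List Symb)) => p.2.1.2 := PolyTime.snd.comp (PolyTime.fst.comp .snd)
  have g₃ : PolyTime fun p : (List Symb × List Symb) × ((Bool × List Symb) ×
    (List Symb × List Symb)) => p.2.2.1 := PolyTime.fst.comp (PolyTime.snd.comp .snd)
  have g₄ : PolyTime fun p : (List Symb × List Symb) × ((Bool × List Symb) ×
    (List Symb × List Symb)) => p.2.2.2 := PolyTime.snd.comp (PolyTime.snd.comp .snd)
  have g₀ : PolyTime fun p : (List Symb × List Symb) × ((Bool × List Symb) ×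
    (List Symb × List Symb)) => p.1.2 := PolyTime.snd.comp .fst
  have hstep : ∀ s, PolyTime fun p : (List Symb × List Symb) × ((Bool × List Symb) ×
      (List Symb × List Symb)) => wordStep p.1.2 p.2 s := fun s =>
    (PolyTime.const_bool _).cond
      (((g₁.and ((g₃.eq_nil.not.and (g₃.eq_word g₄).not).and
        (g₂.reverse.entryOK (g₃.before .comma) (g₄.before .comma)))).pair .nil).pair
          (g₃.pair (g₄.after .comma)))
      ((PolyTime.const_bool _).cond
        (((g₁.and (g₂.eq_nil.and (g₃.eq_nil.not.and (g₃.eq_word g₄)))).pair .nil).pair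
          ((g₃.after .comma).pair g₀))
        ((g₁.pair (g₂.cons s)).pair (g₃.pair g₄)))
  have hfold := PolyTime.foldl (α := List Symb × List Symb) (l := fun p => p.1)
    (b := fun p => ((true, []), (p.2, p.2))) (step := fun p => wordStep p.2) .fst
    (((PolyTime.const_bool true).pair .nil).pair (PolyTime.snd.pair .snd)) hstep
    (B := fun p => 1 + size p.1 + (size p.2 + size p.2))
    (((PolyBdd.const 1).add PolyTime.fst.size_bdd).add
      (PolyTime.snd.size_bdd.add PolyTime.snd.size_bdd)) (fun p l' hl => by
        have h := hl.length_le
        obtain ⟨h₁, h₂, h₃⟩ := length_wordStep_le p.2 l'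
        simp only [size_prod, size_bool, size_word]
        omega)
  exact (PolyTime.vecOK .snd).and ((PolyTime.fst.comp (PolyTime.fst.comp hfold)).and
    ((PolyTime.snd.comp (PolyTime.fst.comp hfold)).eq_nil.and
      (PolyTime.fst.comp (PolyTime.snd.comp hfold)).eq_nil))

/-! ### Words and the numbers that they encode -/

theorem before_append {s : Symb} {x : List Symb} (hx : s ∉ x) (y : List Symb) :
    before s (x ++ s :: y) = x := by
  rw [before, List.takeWhile_append_of_pos]
  · simp
  · intro a ha
    simpa using fun h : a = s => hx (h ▸ ha)

theorem after_append {s : Symb} {x : List Symb} (hx : s ∉ x) (y : List Symb) :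
    after s (x ++ s :: y) = y := by
  rw [after, List.dropWhile_append_of_pos]
  · simp
  · intro a ha
    simpa using fun h : a = s => hx (h ▸ ha)

theorem before_append_after {s : Symb} {l : List Symb} (h : s ∈ l) :
    before s l ++ s :: after s l = l := by
  obtain ⟨x, y, rfl, hx⟩ := List.eq_append_cons_of_mem h
  rw [before_append hx, after_append hx]

theorem all_isBit_iff (l : List Symb) : l.all isBit = true ↔ ∃ p : List Bool, l = p.map .bit := by
  constructor
  · intro h
    induction l with
    | nil => exact ⟨[], rfl⟩
    | cons a l ih =>
      rw [List.all_cons, Bool.and_eq_true] at h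
      obtain ⟨p, rfl⟩ := ih h.2
      cases a with
      | bit b => exact ⟨b :: p, rfl⟩
      | _ => cases h.1
  · rintro ⟨p, rfl⟩
    simp [isBit]

theorem isFrac_iff (e : List Symb) : isFrac e = true ↔ ∃ p q : List Bool, bitsValue q ≠ 0 ∧
    e = p.map .bit ++ .slash :: q.map .bit := by
  have hslash : ∀ p : List Bool, Symb.slash ∉ p.map Symb.bit := by simp
  constructor
  · intro h
    simp only [isFrac, Bool.and_eq_true, numEq_eq, Bool.not_eq_true', decide_eq_false_iff_not] at h
    obtain ⟨⟨h₁, h₂⟩, h₃, h₄⟩ := h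
    obtain ⟨p, hp⟩ := (all_isBit_iff _).1 h₂
    obtain ⟨q, hq⟩ := (all_isBit_iff _).1 h₃
    rw [hq, numVal_map_bit] at h₄
    refine ⟨p, q, h₄, ?_⟩
    rw [← hp, ← hq, before_append_after]
    simpa using h₁
  · rintro ⟨p, q, hq, rfl⟩
    simp only [isFrac, before_append (hslash p), after_append (hslash p), numEq_eq,
      numVal_map_bit]
    simp [isBit, numVal, hq]

/-- The value of a fraction of binary numerals. -/
def fracVal (e : List Symb) : ℚ≥0 := (numVal (before .slash e) : ℚ≥0) / numVal (after .slash e)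

/-- The value of a fraction with a sign. -/
def ratVal (e : List Symb) : ℚ := bif isNeg e then -(fracVal (unsign e) : ℚ) else fracVal (unsign e)

theorem numVal_after_ne_zero {e : List Symb} (h : isFrac e = true) :
    numVal (after .slash e) ≠ 0 := by
  simp only [isFrac, Bool.and_eq_true, numEq_eq, Bool.not_eq_true', decide_eq_false_iff_not] at h
  exact h.2.2

theorem encodesNNRat_iff (r : ℚ≥0) (w : List Symb) :
    EncodesNNRat r w ↔ isFrac w = true ∧ r = fracVal w := by
  have hslash : ∀ p : List Bool, Symb.slash ∉ p.map Symb.bit := by simp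
  rw [isFrac_iff]
  constructor
  · rintro ⟨p, q, hq, rfl, rfl⟩
    refine ⟨⟨p, q, hq, rfl⟩, ?_⟩
    rw [fracVal, before_append (hslash p), after_append (hslash p), numVal_map_bit,
      numVal_map_bit]
  · rintro ⟨⟨p, q, hq, rfl⟩, rfl⟩
    refine ⟨p, q, hq, ?_, rfl⟩
    rw [fracVal, before_append (hslash p), after_append (hslash p), numVal_map_bit,
      numVal_map_bit]

theorem isNeg_eq_false_of_isFrac {e : List Symb} (h : isFrac e = true) : isNeg e = false := by
  obtain ⟨p, q, -, rfl⟩ := (isFrac_iff e).1 h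
  cases p <;> simp [isNeg]

theorem encodesRat_iff (r : ℚ) (w : List Symb) :
    EncodesRat r w ↔ isFrac (unsign w) = true ∧ r = ratVal w := by
  constructor
  · rintro ⟨s, v, hv, ⟨rfl, rfl⟩ | ⟨rfl, rfl⟩⟩
    · obtain ⟨h, rfl⟩ := (encodesNNRat_iff _ _).1 hv
      simp [ratVal, unsign, isNeg_eq_false_of_isFrac h, h]
    · obtain ⟨h, rfl⟩ := (encodesNNRat_iff _ _).1 hv
      simp [ratVal, unsign, isNeg, h]
  · rintro ⟨h, rfl⟩
    refine ⟨fracVal (unsign w), unsign w, (encodesNNRat_iff _ _).2 ⟨h, rfl⟩, ?_⟩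
    cases hw : isNeg w
    · left
      simp [ratVal, unsign, hw]
    · right
      refine ⟨by simp [ratVal, hw], ?_⟩
      cases w with
      | nil => simp [isNeg] at hw
      | cons a w =>
        obtain rfl : a = .minus := by simpa [isNeg] using hw
        simp [unsign, hw]

theorem sq_sub_frac_eq_iff (a c p : ℕ) {b d q : ℕ} (hb : b ≠ 0) (hd : d ≠ 0) (hq : q ≠ 0) :
    ((a / b - c / d : ℚ) ^ 2 = (p / q) ^ 2 ↔
      a * d * q = c * b * q + p * b * d ∨ c * b * q = a * d * q + p * b * d) ∧
    ((a / b + c / d : ℚ) ^ 2 = (p / q) ^ 2 ↔ a * d * q + c * b * q = p * b * d) := by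
  have hb' : (b : ℚ) ≠ 0 := Nat.cast_ne_zero.2 hb
  have hd' : (d : ℚ) ≠ 0 := Nat.cast_ne_zero.2 hd
  have hq' : (q : ℚ) ≠ 0 := Nat.cast_ne_zero.2 hq
  have e₁ : (a / b : ℚ) = (a * d * q : ℕ) / (b * d * q : ℕ) := by push_cast; field_simp
  have e₂ : (c / d : ℚ) = (c * b * q : ℕ) / (b * d * q : ℕ) := by push_cast; field_simp
  have e₃ : (p / q : ℚ) = (p * b * d : ℕ) / (b * d * q : ℕ) := by push_cast; field_simp
  have hD : ((b * d * q : ℕ) : ℚ) ≠ 0 := by push_cast; positivity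
  rw [e₁, e₂, e₃]
  generalize a * d * q = A, c * b * q = B, p * b * d = C, b * d * q = D at *
  rw [← sub_div, ← add_div, div_pow, div_pow, div_pow, div_left_inj' (pow_ne_zero 2 hD),
    div_left_inj' (pow_ne_zero 2 hD), sq_eq_sq_iff_eq_or_eq_neg]
  constructor
  · rw [← @Nat.cast_inj ℚ, ← @Nat.cast_inj ℚ]
    push_cast
    constructor
    · rintro (h | h)
      · left; linarith
      · right; linarith
    · rintro (h | h)
      · left; linarith
      · right; linarith
  · rw [sq_eq_sq₀ (by positivity) (by positivity), ← @Nat.cast_inj ℚ]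
    push_cast
    rfl

theorem distOK_iff {e u v : List Symb} (he : isFrac e = true) (hu : isFrac (unsign u) = true)
    (hv : isFrac (unsign v) = true) :
    distOK e u v = true ↔ (ratVal u - ratVal v) ^ 2 = (fracVal e : ℚ) ^ 2 := by
  have hu' := numVal_after_ne_zero hu
  have hv' := numVal_after_ne_zero hv
  obtain ⟨h₁, h₂⟩ := sq_sub_frac_eq_iff (numVal (before .slash (unsign u)))
    (numVal (before .slash (unsign v))) (numVal (before .slash e)) hu' hv'
    (numVal_after_ne_zero he)
  have hcast : ∀ w, (fracVal w : ℚ) = numVal (before .slash w) / numVal (after .slash w) :=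
    fun w => by simp [fracVal]
  simp only [distOK, ratVal, hcast, numEq_eq, numVal_numMul, numVal_numAdd]
  cases isNeg u <;> cases isNeg v
  · simpa using h₁.symm
  · simpa using h₂.symm
  · rw [show ∀ x y : ℚ, ((bif true then -x else x) - bif false then -y else y) ^ 2 =
      (x + y) ^ 2 from fun x y => by simp only [cond_true, cond_false]; ring, h₂]
    simp
  · rw [show ∀ x y : ℚ, ((bif true then -x else x) - bif true then -y else y) ^ 2 =
      (x - y) ^ 2 from fun x y => by simp only [cond_true]; ring, h₁]
    simp

/-! ### Correctness of the verification algorithm -/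

/-- The words of a list, each followed by a comma. -/
def joinComma (cs : List (List Symb)) : List Symb := cs.flatMap fun x => x ++ [.comma]

/-- The rows of a matrix, each a list of entries. -/
def joinRows (rows : List (List (List Symb))) : List Symb :=
  rows.flatMap fun r => joinComma r ++ [.endRow]

@[simp] theorem joinComma_nil : joinComma [] = [] := rfl

@[simp] theorem joinComma_cons (x cs) :
    joinComma (x :: cs) = x ++ .comma :: joinComma cs := by simp [joinComma]

@[simp] theorem joinRows_nil : joinRows [] = [] := rfl

@[simp] theorem joinRows_nil_cons (rows) : joinRows ([] :: rows) = .endRow :: joinRows rows := by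
  simp [joinRows]

@[simp] theorem joinRows_cons_cons (e r rows) :
    joinRows ((e :: r) :: rows) = e ++ .comma :: joinRows (r :: rows) := by simp [joinRows]

/-- Does the word contain no separators? -/
def Plain (x : List Symb) : Prop := Symb.comma ∉ x ∧ Symb.endRow ∉ x

theorem plain_nil : Plain [] := ⟨by simp, by simp⟩

theorem Plain.reverse {x : List Symb} (h : Plain x) : Plain x.reverse := by
  simpa [Plain] using h

theorem append_cons_inj {s s' : Symb} {a a' l l' : List Symb} (h₁ : s' ∉ a) (h₂ : s ∉ a')
    (h : a ++ s :: l = a' ++ s' :: l') : a = a' ∧ s = s' ∧ l = l' := by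
  induction a generalizing a' with
  | nil =>
    cases a' with
    | nil => simpa using h
    | cons b a' =>
      simp only [List.nil_append, List.cons_append, List.cons.injEq] at h
      exact absurd h.1 (by rintro rfl; simp at h₂)
  | cons b a ih =>
    cases a' with
    | nil =>
      simp only [List.nil_append, List.cons_append, List.cons.injEq] at h
      exact absurd h.1 (by rintro rfl; simp at h₁)
    | cons b' a' =>
      simp only [List.cons_append, List.cons.injEq] at h
      obtain ⟨rfl, h⟩ := h
      obtain ⟨h₃, h₄⟩ := ih (fun h => h₁ (by simp [h])) (fun h => h₂ (by simp [h])) h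
      exact ⟨by rw [h₃], h₄⟩

theorem plain_of_isFrac {e : List Symb} (h : isFrac e = true) : Plain e := by
  obtain ⟨p, q, -, rfl⟩ := (isFrac_iff e).1 h
  simp [Plain]

theorem plain_of_isFrac_unsign {e : List Symb} (h : isFrac (unsign e) = true) : Plain e := by
  have := plain_of_isFrac h
  cases he : isNeg e
  · simpa [unsign, he] using this
  · cases e with
    | nil => exact plain_nil
    | cons a e =>
      obtain rfl : a = .minus := by simpa [isNeg] using he
      simpa [unsign, he, Plain] using this

theorem plain_of_entryOK {e u v : List Symb} (h : entryOK e u v = true) : Plain e := by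
  simp only [entryOK, Bool.or_eq_true, Bool.and_eq_true, decide_eq_true_iff] at h
  rcases h with rfl | h
  · simp [Plain]
  · exact plain_of_isFrac h.1

theorem vecStep_foldl_iff (c : List Symb) (ok : Bool) (t : List Symb) (ht : Symb.comma ∉ t) :
    ((c.foldl vecStep (ok, t)).1 = true ∧ (c.foldl vecStep (ok, t)).2 = []) ↔
      ok = true ∧ ∃ cs : List (List Symb), (∀ x ∈ cs, isFrac (unsign x) = true) ∧
        t.reverse ++ c = joinComma cs := by
  induction c generalizing ok t with
  | nil =>
    refine and_congr_right fun _ => ?_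
    constructor
    · intro h
      exact ⟨[], by simp, by simpa using h⟩
    · rintro ⟨cs, -, h⟩
      cases cs with
      | nil => simpa using h
      | cons x cs =>
        exfalso
        apply ht
        rw [← List.mem_reverse, ← List.append_nil t.reverse, h]
        simp
  | cons s c ih =>
    rw [List.foldl_cons, vecStep]
    by_cases hs : s = .comma
    · subst hs
      simp only [decide_true, cond_true]
      rw [ih _ _ (by simp), Bool.and_eq_true, and_assoc]
      refine and_congr_right fun _ => ?_
      constructor
      · rintro ⟨h, cs, hcs, h'⟩
        exact ⟨t.reverse :: cs, by simpa [h] using hcs, by simpa using h'⟩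
      · rintro ⟨cs, hcs, h⟩
        cases cs with
        | nil => simp at h
        | cons x cs =>
          have hx : isFrac (unsign x) = true := hcs x (by simp)
          rw [joinComma_cons] at h
          obtain ⟨h₁, -, h₂⟩ := append_cons_inj (by simpa using ht)
            (plain_of_isFrac_unsign hx).1 h
          exact ⟨h₁ ▸ hx, cs, fun y hy => hcs y (by simp [hy]), by simpa using h₂⟩
    · simp only [hs, decide_false, cond_false]
      rw [ih _ _ (by simpa [ht] using fun h : Symb.comma = s => hs h.symm)]
      simp

theorem vecOK_iff (c : List Symb) : vecOK c = true ↔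
    ∃ cs : List (List Symb), (∀ x ∈ cs, isFrac (unsign x) = true) ∧ c = joinComma cs := by
  rw [vecOK, Bool.and_eq_true, decide_eq_true_iff, vecStep_foldl_iff c true [] (by simp)]
  simp

theorem joinComma_inj {cs cs' : List (List Symb)} (h : ∀ x ∈ cs, Plain x)
    (h' : ∀ x ∈ cs', Plain x) (e : joinComma cs = joinComma cs') : cs = cs' := by
  induction cs generalizing cs' with
  | nil =>
    cases cs' with
    | nil => rfl
    | cons x cs' => simp at e
  | cons x cs ih =>
    cases cs' with
    | nil => simp at e
    | cons x' cs' =>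
      rw [joinComma_cons, joinComma_cons] at e
      obtain ⟨rfl, -, e⟩ := append_cons_inj (h x (by simp)).1 (h' x' (by simp)).1 e
      rw [ih (fun y hy => h y (by simp [hy])) (fun y hy => h' y (by simp [hy])) e]

/-- The entries `r` of row `i`, from column `j` on, pass the test against the coordinates `cs`. -/
def RowOK (cs : List (List Symb)) (i : ℕ) : ℕ → List (List Symb) → Prop
  | j, [] => j = i
  | j, e :: r => j < i ∧ entryOK e (cs.getD i []) (cs.getD j []) = true ∧ RowOK cs i (j + 1) r

/-- The rows from row `i` and column `j` on pass the test against the coordinates `cs`. -/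
def RowsOK (cs : List (List Symb)) : ℕ → ℕ → List (List (List Symb)) → Prop
  | i, _, [] => i = cs.length
  | i, j, r :: rows => i < cs.length ∧ RowOK cs i j r ∧ RowsOK cs (i + 1) 0 rows

theorem wordAccepts_foldl_false (c w t x y : List Symb) :
    wordAccepts (w.foldl (wordStep c) ((false, t), (x, y))) = false := by
  induction w generalizing t x y with
  | nil => rfl
  | cons s w ih =>
    rw [List.foldl_cons, wordStep]
    cases decide (s = .comma)
    · cases decide (s = .endRow) <;> exact ih _ _ _
    · exact ih _ _ _

theorem wordAccepts_foldl_iff {cs : List (List Symb)} (hcs : ∀ x ∈ cs, Plain x) (w t : List Symb)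
    (ht : Plain t) {i j : ℕ} (hi : i ≤ cs.length) (hj : j ≤ i) :
    wordAccepts (w.foldl (wordStep (joinComma cs))
      ((true, t), (joinComma (cs.drop i), joinComma (cs.drop j)))) = true ↔
      ∃ rows, RowsOK cs i j rows ∧ t.reverse ++ w = joinRows rows := by
  have hnil : ∀ i, i ≤ cs.length → (joinComma (cs.drop i) = [] ↔ i = cs.length) := by
    intro i hi
    constructor
    · intro h
      by_contra hne
      rw [List.drop_eq_getElem_cons (by omega : i < cs.length), joinComma_cons] at h
      exact absurd h (by simp)
    · rintro rfl
      simp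
  have hinj : ∀ i j, i ≤ cs.length → j ≤ cs.length →
      (joinComma (cs.drop i) = joinComma (cs.drop j) ↔ i = j) := by
    intro i j hi hj
    constructor
    · intro h
      have := congrArg List.length (joinComma_inj (fun x hx => hcs x (List.mem_of_mem_drop hx))
        (fun x hx => hcs x (List.mem_of_mem_drop hx)) h)
      rw [List.length_drop, List.length_drop] at this
      omega
    · rintro rfl
      rfl
  have hdrop : ∀ i, i < cs.length → joinComma (cs.drop i) =
      cs.getD i [] ++ .comma :: joinComma (cs.drop (i + 1)) := by
    intro i hi
    rw [List.drop_eq_getElem_cons hi, joinComma_cons, List.getD_eq_getElem _ _ hi]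
  have hplain : ∀ i, i < cs.length → Symb.comma ∉ cs.getD i [] := by
    intro i hi
    rw [List.getD_eq_getElem _ _ hi]
    exact (hcs _ (List.getElem_mem hi)).1
  have hbefore : ∀ i, i < cs.length → before .comma (joinComma (cs.drop i)) = cs.getD i [] :=
    fun i hi => by rw [hdrop i hi, before_append (hplain i hi)]
  have hafter : ∀ i, i < cs.length →
      after .comma (joinComma (cs.drop i)) = joinComma (cs.drop (i + 1)) :=
    fun i hi => by rw [hdrop i hi, after_append (hplain i hi)]
  induction w generalizing t i j with
  | nil =>
    rw [List.foldl_nil, wordAccepts, Bool.and_eq_true, Bool.and_eq_true, decide_eq_true_iff,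
      decide_eq_true_iff, hnil i hi, List.append_nil]
    simp only [true_and]
    constructor
    · rintro ⟨rfl, h⟩
      exact ⟨[], h, rfl⟩
    · rintro ⟨rows, h, h'⟩
      cases rows with
      | nil => exact ⟨by simpa using h', h⟩
      | cons r rows =>
        exfalso
        apply ht.2
        rw [← List.mem_reverse, h']
        simp [joinRows]
  | cons s w ih =>
    rw [List.foldl_cons, wordStep]
    by_cases hs : s = .comma
    · subst hs
      simp only [decide_true, cond_true, Bool.true_and]
      have key : (∃ rows, RowsOK cs i j rows ∧ t.reverse ++ .comma :: w = joinRows rows) ↔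
          (i < cs.length ∧ j < i ∧
            entryOK t.reverse (cs.getD i []) (cs.getD j []) = true) ∧
          ∃ rows, RowsOK cs i (j + 1) rows ∧ w = joinRows rows := by
        constructor
        · rintro ⟨rows, h, h'⟩
          cases rows with
          | nil => simp at h'
          | cons r rows =>
            obtain ⟨h₁, h₂, h₃⟩ := h
            cases r with
            | nil =>
              rw [joinRows_nil_cons] at h'
              have := append_cons_inj (a' := []) ht.reverse.2 (by simp) h'
              simp at this
            | cons e r =>
              obtain ⟨h₄, h₅, h₆⟩ := h₂
              rw [joinRows_cons_cons] at h'
              obtain ⟨h₇, -, h₈⟩ := append_cons_inj ht.reverse.1 (plain_of_entryOK h₅).1 h'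
              exact ⟨⟨h₁, h₄, h₇ ▸ h₅⟩, r :: rows, ⟨h₁, h₆, h₃⟩, h₈⟩
        · rintro ⟨⟨h₁, h₂, h₃⟩, rows, h, h'⟩
          cases rows with
          | nil => exact absurd h h₁.ne
          | cons r rows =>
            obtain ⟨-, h₄, h₅⟩ := h
            exact ⟨(t.reverse :: r) :: rows, ⟨h₁, ⟨h₂, h₃, h₄⟩, h₅⟩, by
              rw [joinRows_cons_cons, h']⟩
      rw [key]
      by_cases hcond : i < cs.length ∧ j < i ∧
          entryOK t.reverse (cs.getD i []) (cs.getD j []) = true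
      · obtain ⟨h₁, h₂, h₃⟩ := hcond
        have e₁ : decide (joinComma (cs.drop i) = []) = false := by
          rw [decide_eq_false_iff_not, hnil i hi]
          omega
        have e₂ : decide (joinComma (cs.drop i) = joinComma (cs.drop j)) = false := by
          rw [decide_eq_false_iff_not, hinj i j hi (by omega)]
          omega
        rw [e₁, e₂, hbefore i h₁, hbefore j (by omega), hafter j (by omega), h₃]
        simp only [Bool.not_false, Bool.and_self]
        refine (ih [] plain_nil hi (by omega)).trans ?_
        simp [h₁, h₂]
      · have : ((!decide (joinComma (cs.drop i) = []) &&
            !decide (joinComma (cs.drop i) = joinComma (cs.drop j))) &&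
              entryOK t.reverse (before .comma (joinComma (cs.drop i)))
                (before .comma (joinComma (cs.drop j)))) = false := by
          rw [Bool.eq_false_iff]
          intro h
          simp only [Bool.and_eq_true, Bool.not_eq_true', decide_eq_false_iff_not, hnil i hi,
            hinj i j hi (hj.trans hi)] at h
          obtain ⟨⟨h₁, h₂⟩, h₃⟩ := h
          rw [hbefore i (by omega), hbefore j (by omega)] at h₃
          exact hcond ⟨by omega, by omega, h₃⟩
        rw [this, wordAccepts_foldl_false]
        simp only [Bool.false_eq_true, false_iff, not_and]
        exact fun h => absurd h hcond
    · by_cases hs' : s = .endRow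
      · subst hs'
        simp only [reduceCtorEq, decide_false, decide_true, cond_true, cond_false, Bool.true_and]
        have key : (∃ rows, RowsOK cs i j rows ∧ t.reverse ++ .endRow :: w = joinRows rows) ↔
            (t = [] ∧ i < cs.length ∧ i = j) ∧
            ∃ rows, RowsOK cs (i + 1) 0 rows ∧ w = joinRows rows := by
          constructor
          · rintro ⟨rows, h, h'⟩
            cases rows with
            | nil => simp at h'
            | cons r rows =>
              obtain ⟨h₁, h₂, h₃⟩ := h
              cases r with
              | nil =>
                rw [joinRows_nil_cons] at h'
                obtain ⟨h₄, -, h₅⟩ := append_cons_inj (a' := []) ht.reverse.2 (by simp) h'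
                exact ⟨⟨by simpa using h₄, h₁, h₂.symm⟩, rows, h₃, h₅⟩
              | cons e r =>
                rw [joinRows_cons_cons] at h'
                have := append_cons_inj ht.reverse.1 (plain_of_entryOK h₂.2.1).2 h'
                simp at this
          · rintro ⟨⟨rfl, h₁, rfl⟩, rows, h, h'⟩
            exact ⟨[] :: rows, ⟨h₁, rfl, h⟩, by rw [joinRows_nil_cons, h']; rfl⟩
        rw [key]
        by_cases hcond : t = [] ∧ i < cs.length ∧ i = j
        · obtain ⟨rfl, h₁, rfl⟩ := hcond
          have e₁ : decide (joinComma (cs.drop i) = []) = false := by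
            rw [decide_eq_false_iff_not, hnil i hi]
            omega
          rw [e₁, hafter i h₁]
          have := ih [] plain_nil (i := i + 1) (j := 0) (by omega) (by omega)
          rw [List.drop_zero] at this
          simp [this, h₁]
        · have : (decide (t = []) && (!decide (joinComma (cs.drop i) = []) &&
              decide (joinComma (cs.drop i) = joinComma (cs.drop j)))) = false := by
            rw [Bool.eq_false_iff]
            intro h
            simp only [Bool.and_eq_true, Bool.not_eq_true', decide_eq_false_iff_not, hnil i hi,
              hinj i j hi (hj.trans hi), decide_eq_true_iff] at h
            exact hcond ⟨h.1, by omega, h.2.2⟩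
          rw [this, wordAccepts_foldl_false]
          simp only [Bool.false_eq_true, false_iff, not_and]
          exact fun h => absurd h hcond
      · simp only [hs, hs', decide_false, cond_false]
        refine (ih (s :: t) ⟨by simpa [ht.1] using fun h : Symb.comma = s => hs h.symm,
          by simpa [ht.2] using fun h : Symb.endRow = s => hs' h.symm⟩ hi hj).trans ?_
        simp

/-- The algorithm accepts if and only if the words are lists of rows and of coordinates, and all
entries pass the test. -/
theorem verify_iff (w c : List Symb) : verify (w, c) = true ↔
    ∃ (cs : List (List Symb)) (rows : List (List (List Symb))),
      (∀ x ∈ cs, isFrac (unsign x) = true) ∧ c = joinComma cs ∧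
      RowsOK cs 0 0 rows ∧ w = joinRows rows := by
  rw [verify, Bool.and_eq_true, vecOK_iff]
  constructor
  · rintro ⟨⟨cs, hcs, rfl⟩, h⟩
    obtain ⟨rows, h₁, h₂⟩ := (wordAccepts_foldl_iff
      (fun x hx => plain_of_isFrac_unsign (hcs x hx)) w [] plain_nil (Nat.zero_le _) le_rfl).1 h
    exact ⟨cs, rows, hcs, rfl, h₁, h₂⟩
  · rintro ⟨cs, rows, hcs, rfl, h₁, h₂⟩
    exact ⟨⟨cs, hcs, rfl⟩, (wordAccepts_foldl_iff
      (fun x hx => plain_of_isFrac_unsign (hcs x hx)) w [] plain_nil (Nat.zero_le _) le_rfl).2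
        ⟨rows, h₁, h₂⟩⟩

/-! ### Encodings as lists of rows -/

theorem rowOK_iff (cs : List (List Symb)) (i j : ℕ) (r : List (List Symb)) :
    RowOK cs i j r ↔ j + r.length = i ∧
      ∀ k < r.length, entryOK (r.getD k []) (cs.getD i []) (cs.getD (j + k) []) = true := by
  induction r generalizing j with
  | nil => simp [RowOK]
  | cons e r ih =>
    rw [RowOK, ih, List.length_cons]
    constructor
    · rintro ⟨h₁, h₂, h₃, h₄⟩
      refine ⟨by omega, fun k hk => ?_⟩
      cases k with
      | zero => simpa using h₂
      | succ k =>
        rw [List.getD_cons_succ, show j + (k + 1) = j + 1 + k by ring]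
        exact h₄ k (by omega)
    · rintro ⟨h₁, h₂⟩
      refine ⟨by omega, by simpa using h₂ 0 (by omega), by omega, fun k hk => ?_⟩
      have := h₂ (k + 1) (by omega)
      rwa [List.getD_cons_succ, show j + (k + 1) = j + 1 + k by ring] at this

theorem rowsOK_iff (cs : List (List Symb)) (i : ℕ) (rows : List (List (List Symb))) :
    RowsOK cs i 0 rows ↔ i + rows.length = cs.length ∧ ∀ a < rows.length,
      (rows.getD a []).length = i + a ∧ ∀ k < i + a,
        entryOK ((rows.getD a []).getD k []) (cs.getD (i + a) []) (cs.getD k []) = true := by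
  induction rows generalizing i with
  | nil => simp [RowsOK]
  | cons r rows ih =>
    rw [RowsOK, ih, rowOK_iff, List.length_cons]
    constructor
    · rintro ⟨h₁, ⟨h₂, h₃⟩, h₄, h₅⟩
      refine ⟨by omega, fun a ha => ?_⟩
      cases a with
      | zero =>
        refine ⟨by simpa using h₂, fun k hk => ?_⟩
        simpa using h₃ k (by omega)
      | succ a =>
        rw [List.getD_cons_succ, show i + (a + 1) = i + 1 + a by ring]
        exact h₅ a (by omega)
    · rintro ⟨h₁, h₂⟩
      have h₀ := h₂ 0 (by omega)
      rw [List.getD_cons_zero, add_zero] at h₀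
      refine ⟨by omega, ⟨by omega, fun k hk => ?_⟩, by omega, fun a ha => ?_⟩
      · rw [zero_add]
        exact h₀.2 k (by omega)
      · have := h₂ (a + 1) (by omega)
        rwa [List.getD_cons_succ, show i + (a + 1) = i + 1 + a by ring] at this

/-- The rows below the diagonal of a matrix. -/
def triangle (n : ℕ) (e : ℕ → ℕ → List Symb) : List (List (List Symb)) :=
  (List.range n).map fun i => (List.range i).map (e i)

theorem map_getD_range {α : Type} (l : List α) (x : α) :
    (List.range l.length).map (fun i => l.getD i x) = l :=
  List.ext_getElem (by simp) fun i hi _ => by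
    have : i < l.length := by simpa using hi
    simp [List.getElem?_eq_getElem this]

theorem getD_map_range {α : Type} (f : ℕ → α) (x : α) {n i : ℕ} (h : i < n) :
    ((List.range n).map f).getD i x = f i := by
  simp [h]

theorem verify_iff_triangle (w c : List Symb) : verify (w, c) = true ↔
    ∃ (n : ℕ) (d : ℕ → List Symb) (e : ℕ → ℕ → List Symb),
      (∀ v < n, isFrac (unsign (d v)) = true) ∧ c = joinComma ((List.range n).map d) ∧
      (∀ i < n, ∀ j < i, entryOK (e i j) (d i) (d j) = true) ∧ w = joinRows (triangle n e) := by
  rw [verify_iff]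
  constructor
  · rintro ⟨cs, rows, hcs, rfl, h, rfl⟩
    obtain ⟨h₁, h₂⟩ := (rowsOK_iff _ _ _).1 h
    rw [zero_add] at h₁
    simp only [zero_add] at h₂
    refine ⟨cs.length, fun v => cs.getD v [], fun i j => (rows.getD i []).getD j [],
      fun v hv => hcs _ ?_, by rw [map_getD_range], fun i hi j hj => ?_, ?_⟩
    · change cs.getD v [] ∈ cs
      rw [List.getD_eq_getElem _ _ hv]
      exact List.getElem_mem hv
    · exact (h₂ i (by omega)).2 j hj
    · congr 1
      rw [triangle]
      conv_lhs => rw [← map_getD_range rows []]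
      rw [← h₁]
      refine List.map_congr_left fun i hi => ?_
      conv_lhs => rw [← map_getD_range (rows.getD i []) []]
      rw [(h₂ i (List.mem_range.1 hi)).1]
  · rintro ⟨n, d, e, hd, rfl, he, rfl⟩
    refine ⟨_, _, ?_, rfl, (rowsOK_iff _ _ _).2 ⟨by simp [triangle], fun a ha => ?_⟩, rfl⟩
    · intro x hx
      obtain ⟨v, hv, rfl⟩ := List.mem_map.1 hx
      exact hd v (List.mem_range.1 hv)
    · have ha' : a < n := by simpa [triangle] using ha
      rw [zero_add, triangle, getD_map_range _ _ ha']
      refine ⟨by simp, fun k hk => ?_⟩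
      rw [getD_map_range _ _ hk, getD_map_range _ _ ha', getD_map_range _ _ (hk.trans ha')]
      exact he a ha' k hk

theorem map_val_finRange_filter (n : ℕ) (i : Fin n) :
    ((List.finRange n).filter fun j => j < i).map Fin.val = List.range i := by
  have h : ((List.finRange n).filter fun j => j < i).map Fin.val =
      ((List.finRange n).map Fin.val).filter fun j => j < i.val := by
    rw [List.filter_map]
    rfl
  rw [h, List.map_coe_finRange_eq_range]
  obtain ⟨i, hi⟩ := i
  obtain ⟨m, rfl⟩ := Nat.exists_eq_add_of_le hi.le
  rw [List.range_add, List.filter_append, List.filter_eq_self.2 (by simp),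
    List.filter_eq_nil_iff.2 (by simp), List.append_nil]

theorem encodes_iff (I : EDGPInstance) (w : List Symb) : I.Encodes w ↔
    ∃ e : ℕ → ℕ → List Symb, (∀ i j : Fin I.n, j < i → I.EncodesEntry i j (e i j)) ∧
      w = joinRows (triangle I.n e) := by
  have key : ∀ e : ℕ → ℕ → List Symb, joinRows (triangle I.n e) =
      (List.finRange I.n).flatMap fun i =>
        (((List.finRange I.n).filter fun j => j < i).flatMap
          fun j : Fin I.n => e i j ++ [Symb.comma]) ++ [Symb.endRow] := by
    intro e
    rw [triangle, ← List.map_coe_finRange_eq_range, List.map_map, joinRows, List.flatMap_map]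
    refine List.flatMap_congr fun i _ => ?_
    rw [joinComma, Function.comp_apply, ← map_val_finRange_filter, List.map_map,
      List.flatMap_map]
    rfl
  constructor
  · rintro ⟨e, he, rfl⟩
    refine ⟨fun i j => if h : i < I.n ∧ j < I.n then e ⟨i, h.1⟩ ⟨j, h.2⟩ else [], ?_, ?_⟩
    · intro i j hij
      simpa using he i j hij
    · rw [key]
      simp
  · rintro ⟨e, he, rfl⟩
    exact ⟨fun i j => e i j, he, key e⟩

theorem encodesVector_iff {n : ℕ} (y : Fin n → ℚ) (c : List Symb) : EncodesVector y c ↔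
    ∃ d : ℕ → List Symb, (∀ v : Fin n, EncodesRat (y v) (d v)) ∧
      c = joinComma ((List.range n).map d) := by
  have key : ∀ d : ℕ → List Symb, joinComma ((List.range n).map d) =
      (List.finRange n).flatMap fun v : Fin n => d v ++ [Symb.comma] := by
    intro d
    rw [← List.map_coe_finRange_eq_range, List.map_map, joinComma, List.flatMap_map]
    rfl
  constructor
  · rintro ⟨d, hd, rfl⟩
    refine ⟨fun i => if h : i < n then d ⟨i, h⟩ else [], by simpa using hd, ?_⟩
    rw [key]
    simp
  · rintro ⟨d, hd, rfl⟩
    exact ⟨fun v => d v, hd, key d⟩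

/-! ### Realizations on the line -/

namespace EDGPInstance

theorem realizes_one_iff (I : EDGPInstance) (x : Fin I.n → EuclideanSpace ℝ (Fin 1)) :
    I.Realizes 1 x ↔ ∀ u v (h : I.graph.Adj u v),
      (x u 0 - x v 0) ^ 2 = (I.weight ⟨s(u, v), h⟩ : ℝ) ^ 2 := by
  simp [Realizes, IsRealization, EuclideanSpace.real_norm_sq_eq]

theorem rationalRealizes_iff (I : EDGPInstance) (y : Fin I.n → ℚ) :
    I.RationalRealizes y ↔ ∀ u v (h : I.graph.Adj u v),
      (y u - y v) ^ 2 = (I.weight ⟨s(u, v), h⟩ : ℚ) ^ 2 := by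
  rw [RationalRealizes, realizes_one_iff]
  refine forall_congr' fun u => forall_congr' fun v => forall_congr' fun h => ?_
  rw [← @Rat.cast_inj ℝ]
  simp

/-- The instance described by the entries of a matrix below the diagonal. -/
def ofEntries (n : ℕ) (e : ℕ → ℕ → List Symb) : EDGPInstance where
  n := n
  graph :=
    { Adj := fun a b => a ≠ b ∧ e (max a b).val (min a b).val ≠ [.noEdge]
      symm := ⟨fun a b h => ⟨h.1.symm, by rw [max_comm, min_comm]; exact h.2⟩⟩
      loopless := ⟨fun a h => h.1 rfl⟩ }
  weight s := Sym2.lift ⟨fun a b => fracVal (e (max a b).val (min a b).val),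
    fun a b => by simp only [max_comm, min_comm]⟩ s.1

end EDGPInstance

theorem mem_certificates_iff (input : Fin 2 → List Symb) :
    input ∈ EDGP1Certificates ↔ verify (input 0, input 1) = true := by
  rw [verify_iff_triangle]
  constructor
  · rintro ⟨I, y, hw, hc, hy⟩
    obtain ⟨e, he, hw⟩ := (encodes_iff _ _).1 hw
    obtain ⟨d, hd, hc⟩ := (encodesVector_iff _ _).1 hc
    rw [I.rationalRealizes_iff] at hy
    have hd' := fun v => (encodesRat_iff _ _).1 (hd v)
    refine ⟨I.n, d, e, fun v hv => (hd' ⟨v, hv⟩).1, hc, fun i hi j hj => ?_, hw⟩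
    rw [entryOK, Bool.or_eq_true, Bool.and_eq_true, decide_eq_true_iff]
    rcases he ⟨i, hi⟩ ⟨j, hj.trans hi⟩ hj with ⟨h, h'⟩ | ⟨-, h'⟩
    · obtain ⟨h₁, h₂⟩ := (encodesNNRat_iff _ _).1 h'
      refine Or.inr ⟨h₁, (distOK_iff h₁ (hd' ⟨i, hi⟩).1 (hd' ⟨j, hj.trans hi⟩).1).2 ?_⟩
      have := hy _ _ h
      rwa [h₂, (hd' _).2, (hd' _).2] at this
    · exact Or.inl h'
  · rintro ⟨n, d, e, hd, hc, he, hw⟩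
    have he' : ∀ i j : Fin n, j < i → e i j ≠ [.noEdge] → isFrac (e i j) = true ∧
        (ratVal (d i) - ratVal (d j)) ^ 2 = (fracVal (e i j) : ℚ) ^ 2 := by
      intro i j hij h
      have := he i i.2 j hij
      rw [entryOK, Bool.or_eq_true, Bool.and_eq_true, decide_eq_true_iff, or_iff_right h] at this
      exact ⟨this.1, (distOK_iff this.1 (hd i i.2) (hd j j.2)).1 this.2⟩
    refine ⟨.ofEntries n e, fun v => ratVal (d v), (encodes_iff _ _).2 ⟨e, ?_, hw⟩,
      (encodesVector_iff _ _).2 ⟨d, fun v => (encodesRat_iff _ _).2 ⟨hd v v.2, rfl⟩, hc⟩,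
      (EDGPInstance.rationalRealizes_iff _ _).2 ?_⟩
    · intro (i : Fin n) (j : Fin n) (hij : j < i)
      by_cases h : e i j = [.noEdge]
      · refine Or.inr ⟨fun h' => h'.2 ?_, h⟩
        rwa [max_eq_left hij.le, min_eq_right hij.le]
      · refine Or.inl ⟨⟨hij.ne', ?_⟩, (encodesNNRat_iff _ _).2 ⟨(he' i j hij h).1, ?_⟩⟩
        · rwa [max_eq_left hij.le, min_eq_right hij.le]
        · change fracVal (e (max i j).val (min i j).val) = _
          rw [max_eq_left hij.le, min_eq_right hij.le]
    · intro (u : Fin n) (v : Fin n) h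
      change (ratVal (d u) - ratVal (d v)) ^ 2 = (fracVal (e (max u v).val (min u v).val) : ℚ) ^ 2
      obtain ⟨hne, h⟩ := h
      rcases lt_or_gt_of_ne hne with huv | huv
      · rw [max_eq_right huv.le, min_eq_left huv.le] at h ⊢
        rw [← (he' v u huv h).2]
        ring
      · rw [max_eq_left huv.le, min_eq_right huv.le] at h ⊢
        exact (he' u v huv h).2

/-! ### Rational realizations -/

/-- Suppose that the differences of the values of `x` at adjacent vertices are integers divided by
`D`, and at most `W`. Along a walk, differences add up: they remain integers divided by `D`, and are
at most `W` times the length of the walk. -/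
theorem SimpleGraph.Walk.exists_int_eq_mul_sub {V : Type} {G : SimpleGraph V} {x : V → ℝ} {D : ℝ}
    {W : ℝ} (h : ∀ u v, G.Adj u v → (∃ k : ℤ, D * (x u - x v) = k) ∧ |x u - x v| ≤ W) {u v : V}
    (p : G.Walk u v) : (∃ k : ℤ, D * (x u - x v) = k) ∧ |x u - x v| ≤ p.length * W := by
  induction p with
  | nil => exact ⟨⟨0, by simp⟩, by simp⟩
  | @cons u v w hadj p ih =>
    obtain ⟨⟨k, hk⟩, h₁⟩ := h _ _ hadj
    obtain ⟨⟨l, hl⟩, h₂⟩ := ih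
    refine ⟨⟨k + l, by push_cast; rw [← hk, ← hl]; ring⟩, ?_⟩
    rw [SimpleGraph.Walk.length_cons]
    push_cast
    calc |x u - x w| ≤ |x u - x v| + |x v - x w| := abs_sub_le _ _ _
      _ ≤ _ := by linarith

/-- Over a connected graph, all differences of coordinates of a realization are rational. -/
theorem exists_rat_realization_of_connected (I : EDGPInstance) (hI : I.graph.Connected)
    (x : Fin I.n → EuclideanSpace ℝ (Fin 1)) (hx : I.Realizes 1 x) (z : Fin I.n) (q : ℚ) :
    ∃ y : Fin I.n → ℚ, (∀ v, (y v : ℝ) = x v 0 - x z 0 + q) ∧ I.RationalRealizes y := by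
  rw [I.realizes_one_iff] at hx
  have hwalk : ∀ u v (p : I.graph.Walk u v), ∃ r : ℚ, x u 0 - x v 0 = r := by
    intro u v p
    induction p with
    | nil => exact ⟨0, by simp⟩
    | @cons u v w hadj p ih =>
      obtain ⟨r, hr⟩ := ih
      rcases sq_eq_sq_iff_eq_or_eq_neg.1 (hx u v hadj) with h | h
      · refine ⟨I.weight ⟨s(u, v), hadj⟩ + r, ?_⟩
        rw [← sub_add_sub_cancel, h, hr]
        simp
      · refine ⟨-I.weight ⟨s(u, v), hadj⟩ + r, ?_⟩
        rw [← sub_add_sub_cancel, h, hr]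
        simp
  choose r hr using fun v => hwalk v z (hI.preconnected v z).some
  refine ⟨fun v => r v + q, fun v => by rw [hr]; push_cast; rfl, ?_⟩
  rw [I.rationalRealizes_iff]
  intro u v h
  rw [← @Rat.cast_inj ℝ]
  have := hx u v h
  rw [← sub_sub_sub_cancel_right _ _ (x z 0), hr, hr] at this
  push_cast
  rw [add_sub_add_right_eq_sub, this]

theorem numVal_lt (l : List Symb) : numVal l < 2 ^ l.length := by
  induction l with
  | nil => simp [numVal]
  | cons a l ih =>
    rw [numVal, List.length_cons, pow_succ]
    have : (isOne (some a)).toNat ≤ 1 := Bool.toNat_le _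
    omega

/-- The denominator of an entry. -/
def entryDen (e : List Symb) : ℕ := bif isFrac e then numVal (after .slash e) else 1

/-- The product of the denominators of all entries. -/
def commonDen (rows : List (List (List Symb))) : ℕ := (rows.flatten.map entryDen).prod

theorem length_before_le_and_length_after_le (e : List Symb) :
    (before .slash e).length ≤ e.length ∧ (after .slash e).length ≤ e.length := by
  constructor
  · exact (List.takeWhile_prefix _).length_le
  · have := (List.dropWhile_suffix (fun a => decide (a ≠ Symb.slash)) (l := e)).length_le
    simp only [after, List.length_tail]
    omega

theorem entryDen_pos (e : List Symb) : 0 < entryDen e := by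
  unfold entryDen
  cases h : isFrac e
  · simp
  · exact Nat.pos_of_ne_zero (numVal_after_ne_zero h)

theorem entryDen_le (e : List Symb) : entryDen e ≤ 2 ^ e.length := by
  unfold entryDen
  cases isFrac e
  · exact Nat.one_le_two_pow
  · exact (numVal_lt _).le.trans
      (Nat.pow_le_pow_right (by norm_num) (length_before_le_and_length_after_le e).2)

theorem commonDen_pos (rows : List (List (List Symb))) : 0 < commonDen rows := by
  refine List.prod_pos fun d hd => ?_
  obtain ⟨e, -, rfl⟩ := List.mem_map.1 hd
  exact entryDen_pos e

theorem commonDen_le (rows : List (List (List Symb))) :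
    commonDen rows ≤ 2 ^ (joinRows rows).length := by
  induction rows with
  | nil => simp [commonDen]
  | cons r rows ih =>
    induction r with
    | nil =>
      rw [joinRows_nil_cons, List.length_cons]
      exact ih.trans (Nat.pow_le_pow_right (by norm_num) (Nat.le_succ _))
    | cons e r ih' =>
      have : commonDen ((e :: r) :: rows) = entryDen e * commonDen (r :: rows) := by
        simp [commonDen]
      rw [this, joinRows_cons_cons, List.length_append, List.length_cons, pow_add]
      exact Nat.mul_le_mul (entryDen_le e)
        (ih'.trans (Nat.pow_le_pow_right (by norm_num) (Nat.le_succ _)))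

theorem length_le_length_joinRows (rows : List (List (List Symb))) :
    rows.length ≤ (joinRows rows).length ∧
    ∀ e ∈ rows.flatten, e.length ≤ (joinRows rows).length := by
  induction rows with
  | nil => simp
  | cons r rows ih =>
    induction r with
    | nil =>
      rw [joinRows_nil_cons, List.length_cons, List.length_cons]
      refine ⟨by omega, fun e he => ?_⟩
      have := ih.2 e (by simpa using he)
      omega
    | cons e r ih' =>
      simp only [joinRows_cons_cons, List.length_append, List.length_cons]
      refine ⟨by have := ih'.1; simp only [List.length_cons] at this ⊢; omega, fun e' he => ?_⟩
      rw [List.flatten_cons, List.cons_append, List.mem_cons] at he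
      rcases he with rfl | he
      · omega
      · have := ih'.2 e' he
        omega

/-- A numeral for a natural number. -/
def natWord (m : ℕ) : List Symb := m.bits.map .bit

theorem bitsValue_bits (m : ℕ) : bitsValue m.bits = m := by
  have h : m.bits.map Bool.toNat = Nat.digits 2 m := by
    rw [Nat.digits_two_eq_bits]
    exact List.map_congr_left fun b _ => by cases b <;> rfl
  rw [bitsValue, h, Nat.ofDigits_digits]

theorem length_natWord_le {m n : ℕ} (h : m < 2 ^ n) : (natWord m).length ≤ n := by
  rw [natWord, List.length_map, Nat.size_eq_bits_len]
  exact Nat.size_le.2 h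

/-- A word for the fraction with numerator `k` and denominator `D`. -/
def ratWord (k : ℤ) (D : ℕ) : List Symb :=
  (if k < 0 then [.minus] else []) ++ (natWord k.natAbs ++ .slash :: natWord D)

theorem encodesRat_ratWord (k : ℤ) {D : ℕ} (hD : 0 < D) : EncodesRat (k / D) (ratWord k D) := by
  refine ⟨k.natAbs / D, natWord k.natAbs ++ .slash :: natWord D,
    ⟨k.natAbs.bits, D.bits, by rw [bitsValue_bits]; exact hD.ne', by
      rw [bitsValue_bits, bitsValue_bits], rfl⟩, ?_⟩
  by_cases hk : k < 0
  · refine Or.inr ⟨?_, by simp [ratWord, hk]⟩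
    push_cast
    rw [Nat.cast_natAbs, abs_of_neg hk]
    push_cast
    ring
  · refine Or.inl ⟨?_, by simp [ratWord, hk]⟩
    push_cast
    rw [Nat.cast_natAbs, abs_of_nonneg (not_lt.1 hk)]

/-- Every YES instance has a rational realization that is encoded by a short word: with one vertex
of each component at `0`, all coordinates are signed sums of edge weights along simple paths. -/
theorem exists_short_certificate (I : EDGPInstance) (w : List Symb) (hw : I.Encodes w)
    (hI : I.IsYes 1) : ∃ (y : Fin I.n → ℚ) (c : List Symb), I.RationalRealizes y ∧
      EncodesVector y c ∧ c.length ≤ w.length * (4 * w.length + 4) := by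
  obtain ⟨x, hx⟩ := hI
  rw [I.realizes_one_iff] at hx
  obtain ⟨e, he, rfl⟩ := (encodes_iff _ _).1 hw
  set rows := triangle I.n e with hrows
  set N := (joinRows rows).length with hN
  have hn : I.n ≤ N := by
    have := (length_le_length_joinRows rows).1
    rwa [hrows, triangle, List.length_map, List.length_range, ← triangle, ← hrows] at this
  have hD := commonDen_pos rows
  have hDle := commonDen_le rows
  set D := commonDen rows with hDdef
  have hmem : ∀ i j : Fin I.n, j < i → e i j ∈ rows.flatten := by
    intro i j hij
    simp only [hrows, triangle, List.mem_flatten, List.mem_map, List.mem_range,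
      exists_exists_and_eq_and]
    exact ⟨i, i.2, j, hij, rfl⟩
  -- each weight is at most `2 ^ N` and has the denominator `D`
  have hlt : ∀ i j : Fin I.n, j < i → ∀ h : I.graph.Adj i j,
      (∃ k : ℕ, (D : ℝ) * I.weight ⟨s(i, j), h⟩ = k) ∧
        (I.weight ⟨s(i, j), h⟩ : ℝ) ≤ (2 : ℝ) ^ N := by
    intro i j hij h
    obtain ⟨_, he'⟩ := (he i j hij).resolve_right fun h' => h'.1 h
    obtain ⟨h₁, h₂⟩ := (encodesNNRat_iff _ _).1 he'
    have hden := numVal_after_ne_zero h₁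
    have hden' : ((numVal (after .slash (e i j)) : ℕ) : ℝ) ≠ 0 := Nat.cast_ne_zero.2 hden
    have hcast : (I.weight ⟨s(i, j), h⟩ : ℝ) =
        numVal (before .slash (e i j)) / numVal (after .slash (e i j)) := by
      rw [h₂, fracVal]
      simp
    obtain ⟨m, hm⟩ : numVal (after .slash (e i j)) ∣ D := by
      have : entryDen (e i j) ∣ D := List.dvd_prod (List.mem_map_of_mem (hmem i j hij))
      rwa [entryDen, h₁, cond_true] at this
    rw [hcast]
    constructor
    · refine ⟨m * numVal (before .slash (e i j)), ?_⟩
      rw [hm]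
      push_cast
      field_simp
    · have h₃ : (1 : ℝ) ≤ numVal (after .slash (e i j)) := by
        exact_mod_cast Nat.one_le_iff_ne_zero.2 hden
      refine (div_le_self (Nat.cast_nonneg _) h₃).trans ?_
      have h₄ := (length_before_le_and_length_after_le (e i j)).1.trans
        ((length_le_length_joinRows rows).2 _ (hmem i j hij))
      have h₅ := (numVal_lt (before .slash (e i j))).le.trans
        (Nat.pow_le_pow_right (by norm_num) h₄)
      exact_mod_cast h₅
  have hadj : ∀ u v, I.graph.Adj u v →
      (∃ k : ℤ, (D : ℝ) * (x u 0 - x v 0) = k) ∧ |x u 0 - x v 0| ≤ (2 : ℝ) ^ N := by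
    intro u v h
    have hw : (∃ k : ℕ, (D : ℝ) * I.weight ⟨s(u, v), h⟩ = k) ∧
        (I.weight ⟨s(u, v), h⟩ : ℝ) ≤ (2 : ℝ) ^ N := by
      rcases lt_or_gt_of_ne h.ne with huv | huv
      · have := hlt v u huv h.symm
        have e : (⟨s(v, u), h.symm⟩ : I.graph.edgeSet) = ⟨s(u, v), h⟩ := Subtype.ext Sym2.eq_swap
        rwa [e] at this
      · exact hlt u v huv h
    obtain ⟨⟨k, hk⟩, hle⟩ := hw
    refine ⟨?_, ?_⟩
    · rcases sq_eq_sq_iff_eq_or_eq_neg.1 (hx u v h) with h | h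
      · exact ⟨k, by rw [h, hk]; simp⟩
      · exact ⟨-k, by rw [h, mul_neg, hk]; simp⟩
    · rwa [(sq_eq_sq_iff_abs_eq_abs _ _).1 (hx u v h), abs_of_nonneg (by positivity)]
  -- a vertex of each component
  let root : Fin I.n → Fin I.n := fun v => (I.graph.connectedComponentMk v).out
  have hroot : ∀ v, I.graph.Reachable v (root v) := fun v =>
    (SimpleGraph.ConnectedComponent.exact (Quot.out_eq (I.graph.connectedComponentMk v))).symm
  have hk : ∀ v, ∃ k : ℤ, (D : ℝ) * (x v 0 - x (root v) 0) = k ∧ k.natAbs < 2 ^ (3 * N) := by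
    intro v
    obtain ⟨p, hp⟩ := (hroot v).exists_isPath
    obtain ⟨⟨k, hk⟩, hle⟩ := p.exists_int_eq_mul_sub (x := fun v => x v 0) hadj
    refine ⟨k, hk, ?_⟩
    have hlen : p.length < 2 ^ N := by
      have := hp.length_lt
      rw [Fintype.card_fin] at this
      exact (this.trans_le hn).trans Nat.lt_two_pow_self
    have h₁ : (k.natAbs : ℝ) ≤ D * (p.length * 2 ^ N) := by
      rw [Nat.cast_natAbs, Int.cast_abs, ← hk, abs_mul, Nat.abs_cast]
      gcongr
    have h₂ : k.natAbs ≤ D * (p.length * 2 ^ N) := by exact_mod_cast h₁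
    refine h₂.trans_lt ?_
    rw [show 3 * N = N + (N + N) by ring, pow_add, pow_add]
    have h₃ : 0 < 2 ^ N := by positivity
    calc D * (p.length * 2 ^ N) < D * (2 ^ N * 2 ^ N) := by gcongr
      _ ≤ 2 ^ N * (2 ^ N * 2 ^ N) := by gcongr
  choose k hk hklt using hk
  have hD' : (D : ℝ) ≠ 0 := Nat.cast_ne_zero.2 hD.ne'
  refine ⟨fun v => k v / D, _, ?_, ⟨fun v => ratWord (k v) D,
    fun v => encodesRat_ratWord _ hD, rfl⟩, ?_⟩
  · rw [I.rationalRealizes_iff]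
    intro u v h
    have hr : root u = root v := by
      have : I.graph.connectedComponentMk u = I.graph.connectedComponentMk v :=
        SimpleGraph.ConnectedComponent.sound h.reachable
      simp only [root, this]
    rw [← @Rat.cast_inj ℝ]
    push_cast
    rw [← hk, ← hk, mul_div_cancel_left₀ _ hD', mul_div_cancel_left₀ _ hD', hr,
      sub_sub_sub_cancel_right, hx u v h]
  · have h₁ : ∀ v, (ratWord (k v) D ++ [Symb.comma]).length ≤ 4 * N + 4 := by
      intro v
      have h₂ := length_natWord_le (hklt v)
      have h₃ : (natWord D).length ≤ N + 1 :=
        length_natWord_le (hDle.trans_lt (Nat.pow_lt_pow_right (by norm_num) (Nat.lt_succ_self _)))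
      have h₄ : (if k v < 0 then [Symb.minus] else []).length ≤ 1 := by split_ifs <;> simp
      simp only [ratWord, List.length_append, List.length_cons, List.length_nil]
      omega
    rw [List.length_flatMap]
    refine (List.sum_le_card_nsmul _ (4 * N + 4) fun m hm => ?_).trans ?_
    · obtain ⟨v, -, rfl⟩ := List.mem_map.1 hm
      exact h₁ v
    · rw [List.length_map, List.length_finRange, smul_eq_mul]
      exact Nat.mul_le_mul_right _ hn

/-! ### The complexity of the problem -/

/-- A word whose length bounds the length of a certificate for an instance encoded by `w`. -/
def clock (w : List Symb) : List Symb :=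
  w.foldl (fun r _ => (w ++ (w ++ (w ++ (w ++ [.comma, .comma, .comma, .comma])))) ++ r) []

theorem length_foldl_append (w m r : List Symb) :
    (w.foldl (fun r _ => m ++ r) r).length = w.length * m.length + r.length := by
  induction w generalizing r with
  | nil => simp
  | cons a w ih =>
    rw [List.foldl_cons, ih, List.length_append, List.length_cons]
    ring

theorem length_clock (w : List Symb) : (clock w).length = w.length * (4 * w.length + 4) := by
  rw [clock, length_foldl_append]
  simp only [List.length_append, List.length_cons, List.length_nil]
  ring

theorem polyTime_clock : PolyTime clock := by
  have h : PolyTime fun p : List Symb × List Symb =>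
      p.1 ++ (p.1 ++ (p.1 ++ (p.1 ++ [.comma, .comma, .comma, .comma]))) :=
    PolyTime.fst.append (PolyTime.fst.append (PolyTime.fst.append (PolyTime.fst.append
      ((((PolyTime.nil.cons _).cons _).cons _).cons _))))
  refine PolyTime.foldl (l := fun w => w) (b := fun _ => []) (step := fun w r _ =>
    (w ++ (w ++ (w ++ (w ++ [.comma, .comma, .comma, .comma])))) ++ r) .id .nil
    (fun s => h.append .snd) (B := fun w => Coded.size w * (4 * Coded.size w + 4))
    (PolyBdd.size.mul (((PolyBdd.const 4).mul .size).add (.const 4))) fun w l' hl => ?_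
  rw [Coded.size_word, length_foldl_append]
  have := hl.length_le
  simp only [List.length_append, List.length_cons, List.length_nil, Coded.size_word, add_zero]
  refine (Nat.mul_le_mul_right _ this).trans (le_of_eq ?_)
  ring

theorem mainTheorem2 :
    -- a nondeterministic polynomial-time Turing machine decides the problem
    NondeterministicPolyTime EDGP1 ∧
    -- over a connected graph, a realization becomes rational as soon as a translation
    -- makes one coordinate rational
    (∀ I : EDGPInstance, I.graph.Connected → ∀ x, I.Realizes 1 x → ∀ (z : Fin I.n) (q : ℚ),
      ∃ y : Fin I.n → ℚ, (∀ v, (y v : ℝ) = x v 0 - x z 0 + q) ∧ I.RationalRealizes y) ∧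
    -- YES instances have rational realizations of polynomial size
    (∃ p : Polynomial ℕ, ∀ (I : EDGPInstance) (w : List Symb), I.Encodes w → I.IsYes 1 →
      ∃ (y : Fin I.n → ℚ) (c : List Symb),
        I.RationalRealizes y ∧ EncodesVector y c ∧ c.length ≤ p.eval w.length) ∧
    -- rational realizations can be verified in deterministic polynomial time
    DeterministicPolyTime EDGP1Certificates := by
  refine ⟨polyTime_clock.nondeterministicPolyTime polyTime_verify fun input => ?_,
    exists_rat_realization_of_connected, ⟨.X * (4 * .X + 4), fun I w hw hI => ?_⟩,
    polyTime_verify.deterministicPolyTime mem_certificates_iff⟩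
  · have h : ∀ c, verify (input 0, c) = true ↔ ![input 0, c] ∈ EDGP1Certificates :=
      fun c => (mem_certificates_iff ![input 0, c]).symm
    simp only [h, length_clock]
    constructor
    · rintro ⟨I, hw, hI⟩
      obtain ⟨y, c, hy, hc, hle⟩ := exists_short_certificate I _ hw hI
      exact ⟨c, hle, I, y, hw, hc, hy⟩
    · rintro ⟨c, -, I, y, hw, -, hy⟩
      exact ⟨I, hw, _, hy⟩
  · obtain ⟨y, c, hy, hc, hle⟩ := exists_short_certificate I w hw hI
    exact ⟨y, c, hy, hc, by simpa using hle⟩
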